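/- Let $\mathbb K\in\{\mathbb R,\mathbb C\}$. Consider the two-user MIMO interference channel in which transmitters $1,2$ have $1,3$ antennas and receivers $1,2$ have $2,4$ antennas: in channel use $t=0,1,2,\dots$ $$Y^{[i]}(t)=H^{[i1]}(t)X^{[1]}(t)+H^{[i2]}(t)X^{[2]}(t)+Z^{[i]}(t),\qquad i=1,2,$$ with additive white Gaussian noise $Z^{[i]}$ of unit variance per antenna (circularly symmetric if $\mathbb K=\mathbb C$), independent over time and antennas and independent of the messages and of the random channel matrices $H^{[ij]}(t)\in\mathbb K^{n_i\times m_j}$, where $(m_1,m_2)=(1,3)$ and $(n_1,n_2)=(2,4)$. Transmitter $j$ sends one message, to receiver $j$. The fading satisfies the following. (a) (Staggered block fading at receiver 1.) $H^{[11]}(t)$ and $H^{[12]}(t)$ are constant over blocks of two consecutive channel uses, and the block boundaries of $H^{[11]}$ and of $H^{[12]}$ are offset from each other by one channel use. (b) (Generic channel states.) Whenever a block boundary of $H^{[11]}$ separates $t$ from $t+1$, the joint law of $(H^{[11]}(t),H^{[11]}(t+1),H^{[12]}(t))$ is absolutely continuous with respect to Lebesgue measure; for every $t$, the joint law of $(H^{[21]}(t),H^{[22]}(t))$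 is absolutely continuous with respect to Lebesgue measure. States of different blocks need not be independent, and no block structure or coherence time is prescribed at receiver 2. (c) For each $i$ the law of the sequence $(H^{[i1]}(t),H^{[i2]}(t))_{t\ge0}$ is invariant under a time shift by some positive number of channel uses. The transmitters know the statistics but not the realization of the channel (no CSIT); receiver $i$ knows the realization of $H^{[i1]},H^{[i2]}$. Then users 1 and 2 can simultaneously achieve $1$ and $\tfrac32$ degrees of freedom, almost surely. That is, there are rates $R_1(P),R_2(P)$ with $$\lim_{P\to\infty}\frac{R_1(P)}{c\log P}=1,\qquad \lim_{P\to\infty}\frac{R_2(P)}{c\log P}=\frac32,\qquad c=\begin{cases}1/2,&\mathbb K=\mathbb R\\ 1,&\mathbb K=\mathbb C,\end{cases}$$ and, for every $P>0$ and every block length $n$, a code of length $n$ whose codewords all have average power at most $P$ and which, for all large $n$, has at least $e^{nR_k(P)}$ messages for user $k=1,2$; the rates and the encoding and decoding functions do not depend on the channel realization (the decoder of receiver $i$ has that receiver's channel states as an argument), and for almost every channel realization there is a $P_0$ such that for all $P\ge P_0$ the error probability of each user (average over equiprobable messages), given that realization, tends to $0$ as $n\to\infty$. -/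

import Mathlib

open MeasureTheory ProbabilityTheory Filter Topology
open scoped NNReal

noncomputable section

namespace MIMOIC

/-- The law of one sample of additive white Gaussian noise over `𝕜 = ℝ` or `𝕜 = ℂ`, of unit
variance: `N(0,1)` over `ℝ` (where `RCLike.I = 0`), and the circularly symmetric law `CN(0,1)`
over `ℂ` (independent real and imaginary parts, each `N(0,1/2)`). -/
def noiseLaw (𝕜 : Type*) [RCLike 𝕜] : Measure 𝕜 :=
  ((gaussianReal 0 (Module.finrank ℝ 𝕜 : ℝ≥0)⁻¹).prod
    (gaussianReal 0 (Module.finrank ℝ 𝕜 : ℝ≥0)⁻¹)).map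
      (fun p : ℝ × ℝ => (p.1 : 𝕜) + (p.2 : 𝕜) * RCLike.I)

/-- Channel coefficients seen by receiver `i` in one channel use: for each transmitter `j`, the
`nR i × nT j` array of gains, entry `j r a` being the gain from antenna `a` of transmitter `j` to
antenna `r` of receiver `i`. -/
abbrev RxState (𝕜 : Type*) {K : ℕ} (nT nR : Fin K → ℕ) (i : Fin K) : Type _ :=
  (j : Fin K) → Fin (nR i) → Fin (nT j) → 𝕜

/-- Signals received over `n` channel uses by a receiver with `r` antennas. -/
abbrev RxSignal (𝕜 : Type*) (r n : ℕ) : Type _ := Fin n → Fin r → 𝕜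

/-- Receiver noise over `n` channel uses: i.i.d. over time and antennas. -/
def noise (𝕜 : Type*) [RCLike 𝕜] (r n : ℕ) : Measure (RxSignal 𝕜 r n) :=
  Measure.pi fun _ => Measure.pi fun _ => noiseLaw 𝕜

/-- A block code of length `n` for the `K`-user MIMO interference channel with one message per
user. There is no CSIT: a codeword depends only on the message of its own user. There is perfect
CSIR: the decoder of receiver `k` is given the channel states of receiver `k` over the `n` channel
uses, along with the received signal. -/
structure Code (𝕜 : Type*) [RCLike 𝕜] {K : ℕ} (nT nR : Fin K → ℕ) (n : ℕ) where
  /-- number of messages of user `k` -/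
  M : Fin K → ℕ
  /-- encoders -/
  enc : (k : Fin K) → Fin (M k) → Fin n → Fin (nT k) → 𝕜
  /-- decoders -/
  dec : (k : Fin K) → (Fin n → RxState 𝕜 nT nR k) → RxSignal 𝕜 (nR k) n → Fin (M k)
  measurable_dec : ∀ k, Measurable fun q : (Fin n → RxState 𝕜 nT nR k) × RxSignal 𝕜 (nR k) n =>
    dec k q.1 q.2

namespace Code

variable {𝕜 : Type*} [RCLike 𝕜] {K : ℕ} {nT nR : Fin K → ℕ} {n : ℕ}

/-- Every codeword of every user has average power (summed over antennas) at most `P`. -/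
def PowerConstraint (C : Code 𝕜 nT nR n) (P : ℝ) : Prop :=
  ∀ (k : Fin K) (m : Fin (C.M k)), ∑ t, ∑ a, ‖C.enc k m t a‖ ^ 2 ≤ n * P

/-- The signal at receiver `i` when the messages are `m`, the channel states at receiver `i` are `h`
and the noise is `z`. -/
def output (C : Code 𝕜 nT nR n) (i : Fin K) (h : Fin n → RxState 𝕜 nT nR i)
    (m : (k : Fin K) → Fin (C.M k)) (z : RxSignal 𝕜 (nR i) n) : RxSignal 𝕜 (nR i) n :=
  fun t r => ∑ j, ∑ a, h t j r a * C.enc j (m j) t a + z t r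

/-- Probability of error of user `i` for given channel states `h` at its receiver, averaged over
equiprobable messages of all users. -/
def errorProb (C : Code 𝕜 nT nR n) (i : Fin K) (h : Fin n → RxState 𝕜 nT nR i) : ℝ :=
  (∑ m : (k : Fin K) → Fin (C.M k),
      (noise 𝕜 (nR i) n).real {z | C.dec i h (C.output i h m z) ≠ m i}) /
    (Fintype.card ((k : Fin K) → Fin (C.M k)) : ℝ)

end Code

variable {𝕜 : Type*} [RCLike 𝕜] {K : ℕ} {nT nR : Fin K → ℕ}
  {Ω : Type*} [MeasurableSpace Ω]

/-- The users can simultaneously achieve `d k` degrees of freedom, almost surely, without CSIT, over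
the random time-varying channel `H` (`H i t ω` being the state at receiver `i` and time `t`).

There are rates `R P k` with `R P k / log P → d k` (`R P k / (½ log P) → d k` over `ℝ`), and, for
each power `P`, codes of all lengths `n` that obey the power constraint and have at least
`exp (n * R P k)` messages for large `n`. The rates and the codes do not depend on the channel
realization `ω`. For almost every realization, for all large `P` the error probability of each user
given that realization tends to zero as `n → ∞`. -/
def AchievesDoF (μ : Measure Ω) (H : (i : Fin K) → ℕ → Ω → RxState 𝕜 nT nR i)
    (d : Fin K → ℝ) : Prop :=
  ∃ (R : ℝ → Fin K → ℝ) (C : ℝ → (n : ℕ) → Code 𝕜 nT nR n),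
    (∀ k, Tendsto (fun P => R P k / ((Module.finrank ℝ 𝕜 : ℝ) / 2 * Real.log P)) atTop (𝓝 (d k))) ∧
    (∀ P > 0, ∀ n, (C P n).PowerConstraint P) ∧
    (∀ P > 0, ∀ k, ∀ᶠ n : ℕ in atTop, Real.exp (n * R P k) ≤ (C P n).M k) ∧
    ∀ᵐ ω ∂μ, ∀ᶠ P in atTop, ∀ k,
      Tendsto (fun n : ℕ => (C P n).errorProb k (fun t => H k t ω)) atTop (𝓝 0)

/-- Times `s` and `t` lie in the same fading block, for blocks of length `T` with offset `o`
(the block boundaries are the times `t` with `t + o` divisible by `T`). -/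
def SameBlock (T o s t : ℕ) : Prop := (s + o) / T = (t + o) / T

/-- The link from transmitter `j` to receiver `i` is constant over fading blocks of length `T` with
offset `o`. -/
def IsBlockFading (H : (i : Fin K) → ℕ → Ω → RxState 𝕜 nT nR i) (i j : Fin K) (T o : ℕ) : Prop :=
  ∀ s t, SameBlock T o s t → ∀ ω, H i s ω j = H i t ω j

/-- The random vector `X` is drawn from a continuous distribution: its law is absolutely continuous
with respect to Lebesgue (Haar) measure. -/
def IsGeneric {E : Type*} [NormedAddCommGroup E] [NormedSpace ℝ E] [FiniteDimensional ℝ E]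
    [MeasurableSpace E] [BorelSpace E] (μ : Measure Ω) (X : Ω → E) : Prop :=
  haveI : ProperSpace E := FiniteDimensional.proper ℝ E
  Measurable X ∧ μ.map X ≪ Measure.addHaar

/-- The law of the whole sequence of channel states at receiver `i` is invariant under a shift of
time by some positive number `p` of channel uses. -/
def IsCyclostationary (μ : Measure Ω) (H : (i : Fin K) → ℕ → Ω → RxState 𝕜 nT nR i)
    (i : Fin K) : Prop :=
  ∃ p : ℕ, 0 < p ∧ IdentDistrib (fun ω t => H i t ω) (fun ω t => H i (t + p) ω) μ μ

/-- Antenna numbers of the two transmitters. -/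
abbrev txAntennas : Fin 2 → ℕ := ![1, 3]

/-- Antenna numbers of the two receivers. -/
abbrev rxAntennas : Fin 2 → ℕ := ![2, 4]

end MIMOIC

end

open MIMOIC

/-!
Interference alignment by staggered fading, made robust by a concatenated code.

*Alignment.* Pair the channel uses so that a block boundary of the direct link of receiver 1 lies
inside each pair. The staggering keeps the interfering link of receiver 1 constant over a pair. User
2 sends three constellation points, one per antenna, and repeats them in the second channel use; user
1 sends two fresh points. At receiver 1 the difference of the two received signals is free of
interference and is a `2 × 2` linear system for the two points of user 1, whose columns are the direct
channels before and after the boundary. Receiver 2 has four antennas, and one channel use gives it a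
`4 × 4` system for all transmitted points. Both systems are generically invertible
(`ae_det_ne_zero`). With about `P ^ (1 / 2)` constellation points per real dimension
(`exists_constellation`, `tendsto_log_levels`) this amounts to `2 / 2` and `3 / 2` degrees of freedom.

*Bad pairs.* A symbol can be lost in a pair if the system is badly conditioned or the noise is large.
An outer Gilbert–Varshamov code over the symbols (`exists_code_of_min_dist`) of relative minimum
distance above `3 / L` tolerates a fraction `1 / L` of each kind (`InnerCode.dec_toCode_eq`) at a loss
of a factor `1 - 3 / L` and of a constant in the rate. Large noise in too many pairs is exponentially
unlikely by a union bound (`pi_lt_mul_card_le`).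

*Almost sure statement without ergodicity.* Nothing is assumed on the integrability of the logarithm
of the determinants, and time averages need not be deterministic. The maximal ergodic inequality
(`measure_exists_lt_birkhoffSum_le`), applied to the number of bad pairs in a period, shows that if the
bound on the inverse matrices is chosen large enough at level `L`, the fraction of bad pairs stays
below `1 / L` at all times, except on an event of probability `2 ^ (1 - L)` per receiver. By
Borel–Cantelli almost every realization is good at all high levels. Finally `L` grows with `P` so slowly that the separation
of the constellation required at level `L` is `P ^ o(1)` (`exists_slow_index`), so that the degrees of
freedom are not affected.
-/

namespace MIMOIC

/-! ### Maximal ergodic inequality and blocks of a cyclostationary process -/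

/-- Covering estimate behind the maximal inequality. If every marked index `i` starts a window, of
length at most `W`, on which the average of `a` exceeds `1 / L`, then the marked indices can be
covered greedily by disjoint windows, so their number is at most `L` times the sum of `a`. -/
lemma card_filter_le_mul_sum_of_windows (a : ℕ → ℕ) (S : ℕ → Prop) [DecidablePred S] (W L : ℕ)
    (hS : ∀ i, S i → ∃ m ≤ W, m < L * ∑ s ∈ Finset.Ico i (i + m), a s) (n : ℕ) :
    ∀ i, ((Finset.Ico i (i + n)).filter S).card ≤ L * ∑ s ∈ Finset.Ico i (i + n + W), a s := by
  induction n using Nat.strong_induction_on with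
  | _ n ih =>
    intro i
    rcases Nat.eq_zero_or_pos n with rfl | hn
    · simp
    have hsplit : ∀ k ≤ n, ((Finset.Ico i (i + n)).filter S).card =
        ((Finset.Ico i (i + k)).filter S).card +
          ((Finset.Ico (i + k) (i + k + (n - k))).filter S).card := by
      intro k hk
      rw [← Finset.card_union_of_disjoint, ← Finset.filter_union,
        Finset.Ico_union_Ico_eq_Ico (by lia) (by lia)]
      · congr 3; lia
      · exact Finset.disjoint_filter_filter (Finset.Ico_disjoint_Ico_consecutive _ _ _)
    by_cases hi : S i
    · obtain ⟨m, hmW, hm⟩ := hS i hi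
      have hm0 : 0 < m := by
        rcases Nat.eq_zero_or_pos m with rfl | h
        · simp at hm
        · exact h
      rcases le_or_gt n m with hnm | hnm
      · calc ((Finset.Ico i (i + n)).filter S).card ≤ n :=
              (Finset.card_filter_le _ _).trans (by simp)
          _ ≤ L * ∑ s ∈ Finset.Ico i (i + m), a s := hnm.trans hm.le
          _ ≤ _ := by
              gcongr
              lia
      · have h1 := ih (n - m) (by lia) (i + m)
        have h2 : ((Finset.Ico i (i + m)).filter S).card ≤ m :=
          (Finset.card_filter_le _ _).trans (by simp)
        have e : i + m + (n - m) + W = i + n + W := by lia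
        rw [e] at h1
        rw [hsplit m hnm.le, ← Finset.sum_Ico_consecutive a (Nat.le_add_right i m)
          (show i + m ≤ i + n + W by lia), mul_add]
        lia
    · have h1 := ih (n - 1) (by lia) (i + 1)
      have h2 : ((Finset.Ico i (i + 1)).filter S).card = 0 := by
        simp [Nat.Ico_succ_singleton, Finset.filter_singleton, hi]
      have e : i + 1 + (n - 1) + W = i + n + W := by lia
      rw [e] at h1
      rw [hsplit 1 hn, h2, zero_add]
      refine h1.trans ?_
      gcongr
      lia

/-- Maximal ergodic inequality: for a measure-preserving map `T` and a nonnegative integer-valued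
`f`, the probability that some Birkhoff average of `f` exceeds `1 / L` is at most `L * ∫ f`. -/
theorem measure_exists_lt_birkhoffSum_le {X : Type*} [MeasurableSpace X] {ν : Measure X}
    [IsProbabilityMeasure ν] {T : X → X} (hT : MeasurePreserving T ν ν) {f : X → ℕ}
    (hf : Measurable f) (L : ℕ) (c : ℝ≥0) (hc : ∫⁻ x, (f x : ENNReal) ∂ν ≤ c) :
    ν {x | ∃ m, m < L * birkhoffSum T f m x} ≤ L * c := by
  classical
  have hfT : ∀ s, Measurable fun x => f (T^[s] x) := fun s => hf.comp (hT.iterate s).measurable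
  have hB : ∀ m, Measurable (birkhoffSum T f m) := fun m => by
    unfold birkhoffSum
    exact Finset.measurable_sum _ fun s _ => hfT s
  let E : ℕ → Set X := fun W => {x | ∃ m ≤ W, m < L * birkhoffSum T f m x}
  have hE : ∀ W, MeasurableSet (E W) := fun W => by
    have : E W = ⋃ m ∈ Set.Iic W, {x | m < L * birkhoffSum T f m x} := by
      ext x; simp [E]
    rw [this]
    refine MeasurableSet.biUnion (Set.to_countable _) fun m _ => ?_
    exact measurableSet_lt measurable_const ((hB m).const_mul L)
  have hmono : Monotone E := fun W W' h x ⟨m, hm, hx⟩ => ⟨m, hm.trans h, hx⟩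
  have hU : {x | ∃ m, m < L * birkhoffSum T f m x} = ⋃ W, E W := by
    ext x
    simp only [Set.mem_ofPred_eq, Set.mem_iUnion, E]
    exact ⟨fun ⟨m, hm⟩ => ⟨m, m, le_rfl, hm⟩, fun ⟨_, m, _, hm⟩ => ⟨m, hm⟩⟩
  rw [hU, hmono.measure_iUnion]
  refine iSup_le fun W => ?_
  -- integrate the covering estimate over the first `n` points of the orbit, then let `n → ∞`
  have key : ∀ n : ℕ, n * ν (E W) ≤ L * ((n + W : ℕ) * c) := by
    intro n
    have hpt : ∀ x, ∑ i ∈ Finset.range n, (E W).indicator (fun _ => (1 : ENNReal)) (T^[i] x) ≤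
        L * ∑ s ∈ Finset.range (n + W), (f (T^[s] x) : ENNReal) := by
      intro x
      have := card_filter_le_mul_sum_of_windows (fun s => f (T^[s] x)) (fun i => T^[i] x ∈ E W) W L
        (by
          rintro i ⟨m, hm, h⟩
          refine ⟨m, hm, ?_⟩
          rw [Finset.sum_Ico_eq_sum_range, Nat.add_sub_cancel_left]
          simpa [birkhoffSum, ← Function.iterate_add_apply, add_comm] using h) n 0
      simp only [zero_add, Nat.Ico_zero_eq_range] at this
      simp only [Set.indicator_apply]
      rw [← Finset.sum_filter, Finset.sum_const, nsmul_eq_mul, mul_one]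
      exact_mod_cast this
    have hint := lintegral_mono (μ := ν) hpt
    have m1 : ∀ i, Measurable fun x => (E W).indicator (fun _ => (1 : ENNReal)) (T^[i] x) :=
      fun i => (measurable_const.indicator (hE W)).comp (hT.iterate i).measurable
    have m2 : ∀ s, Measurable fun x => (f (T^[s] x) : ENNReal) :=
      fun s => (measurable_of_countable (fun k : ℕ => (k : ENNReal))).comp (hfT s)
    rw [lintegral_finsetSum _ fun i _ => m1 i,
      lintegral_const_mul _ (Finset.measurable_sum _ fun s _ => m2 s),
      lintegral_finsetSum _ fun s _ => m2 s] at hint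
    have h1 : ∀ i, ∫⁻ x, (E W).indicator (fun _ => (1 : ENNReal)) (T^[i] x) ∂ν = ν (E W) := by
      intro i
      rw [(hT.iterate i).lintegral_comp (measurable_const.indicator (hE W))]
      simp [lintegral_indicator (hE W)]
    have h2 : ∀ s, ∫⁻ x, (f (T^[s] x) : ENNReal) ∂ν ≤ c := by
      intro s
      rw [(hT.iterate s).lintegral_comp (f := fun y => (f y : ENNReal))
        ((measurable_of_countable (fun k : ℕ => (k : ENNReal))).comp hf)]
      exact hc
    simp only [h1, Finset.sum_const, Finset.card_range, nsmul_eq_mul] at hint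
    refine hint.trans ?_
    gcongr
    refine (Finset.sum_le_sum fun s _ => h2 s).trans ?_
    simp
  have hfin : ν (E W) ≠ ⊤ := measure_ne_top _ _
  lift ν (E W) to ℝ≥0 using hfin with r
  norm_cast at key ⊢
  by_contra! hlt
  have key' : ∀ n : ℕ, (n : ℝ) * (r - L * c) ≤ L * W * c := by
    intro n
    have := key n
    rw [← NNReal.coe_le_coe] at this
    push_cast at this
    linarith
  have hpos : (0 : ℝ) < r - L * c := by
    have := NNReal.coe_lt_coe.2 hlt
    push_cast at this
    linarith
  obtain ⟨n, hn⟩ := exists_nat_gt (L * W * c / (r - L * c) : ℝ)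
  rw [div_lt_iff₀ hpos] at hn
  exact absurd (key' n) (not_le.2 hn)

/-- The entries of a sequence at the times `e + 2 * j` and `e + 2 * j + 1`: the `j`-th of the
disjoint pairs of consecutive entries that start at time `e`. -/
def pairAt {S : Type*} (e j : ℕ) (y : ℕ → S) : Fin 2 → S := fun s => y (e + 2 * j + s)

lemma measurable_pairAt {S : Type*} [MeasurableSpace S] (e j : ℕ) :
    Measurable (pairAt (S := S) e j) :=
  measurable_pi_lambda _ fun _ => measurable_pi_apply _

/-- For a process whose law is invariant under some time shift, and sets `G K` that increase with
`K` and eventually contain each pair of consecutive entries, almost surely: if `K` is large then,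
with probability close to one, at every time `N` at most a fraction `1 / L` of the first `N` pairs
lies outside `G K`. No ergodicity, and no integrability of the first `K` with membership in `G K`,
is needed. -/
theorem exists_measure_bad_pairs_le {Ω S : Type*} [MeasurableSpace Ω] [MeasurableSpace S]
    {μ : Measure Ω} [IsProbabilityMeasure μ] {Y : ℕ → Ω → S} (hY : ∀ t, Measurable (Y t))
    {p : ℕ} (hp : 0 < p)
    (hstat : IdentDistrib (fun ω t => Y t ω) (fun ω t => Y (t + p) ω) μ μ)
    (e : ℕ) {G : ℕ → Set (Fin 2 → S)} (hG : ∀ K, MeasurableSet (G K)) (hmono : Monotone G)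
    (hae : ∀ j, ∀ᵐ ω ∂μ, ∃ K, pairAt e j (fun t => Y t ω) ∈ G K)
    (L : ℕ) {η : ℝ≥0} (hη : 0 < η) :
    ∃ K, μ {ω | ∃ N, N < L * ∑ j ∈ Finset.range N,
      (G K)ᶜ.indicator (1 : (Fin 2 → S) → ℕ) (pairAt e j fun t => Y t ω)} ≤ η := by
  have hseq : Measurable fun ω t => Y t ω := measurable_pi_lambda _ hY
  set ν : Measure (ℕ → S) := μ.map fun ω t => Y t ω with hν
  have : IsProbabilityMeasure ν := Measure.isProbabilityMeasure_map hseq.aemeasurable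
  have hshift : ∀ q : ℕ, Measurable fun (y : ℕ → S) t => y (t + q) := fun q =>
    measurable_pi_lambda _ fun _ => measurable_pi_apply _
  have hp1 : MeasurePreserving (fun (y : ℕ → S) t => y (t + p)) ν ν := by
    refine ⟨hshift p, ?_⟩
    rw [hν, Measure.map_map (hshift p) hseq]
    exact hstat.map_eq.symm
  -- a shift by `2 * p` moves pairs to pairs whatever the parity of `p`
  have hT : MeasurePreserving (fun (y : ℕ → S) t => y (t + 2 * p)) ν ν := by
    have := hp1.comp hp1
    convert this using 1
    ext y t
    simp only [Function.comp]
    congr 1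
    lia
  set T : (ℕ → S) → ℕ → S := fun y t => y (t + 2 * p) with hTdef
  let b : ℕ → ℕ → (ℕ → S) → ℕ := fun K j y => (G K)ᶜ.indicator (1 : (Fin 2 → S) → ℕ) (pairAt e j y)
  have hb : ∀ K j, Measurable (b K j) := fun K j =>
    (measurable_one.indicator (hG K).compl).comp (measurable_pairAt e j)
  have hbT : ∀ K j m y, b K j (T^[m] y) = b K (m * p + j) y := by
    intro K j m y
    have : T^[m] y = fun t => y (t + m * (2 * p)) := by
      induction m generalizing y with
      | zero => simp
      | succ m ih =>
        rw [Function.iterate_succ_apply, ih]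
        ext t
        simp only [hTdef]
        congr 1
        ring
    simp only [b, this]
    congr 1
    ext s
    simp only [pairAt]
    congr 1
    ring
  -- the number of bad pairs in the period of `p` pairs
  let f : ℕ → (ℕ → S) → ℕ := fun K y => ∑ j ∈ Finset.range p, b K j y
  have hf : ∀ K, Measurable (f K) := fun K => Finset.measurable_sum _ fun j _ => hb K j
  have hsum : ∀ K m y, birkhoffSum T (f K) m y = ∑ j ∈ Finset.range (m * p), b K j y := by
    intro K m y
    induction m with
    | zero => simp
    | succ m ih =>
      rw [birkhoffSum_succ, ih, Nat.succ_mul, Finset.sum_range_add]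
      simp [f, hbT]
  have hbint : ∀ K j, ∫⁻ y, (b K j y : ENNReal) ∂ν =
      μ {ω | pairAt e j (fun t => Y t ω) ∉ G K} := by
    intro K j
    have e1 : ∀ y, (b K j y : ENNReal) =
        (pairAt e j ⁻¹' (G K)ᶜ).indicator (fun _ => (1 : ENNReal)) y := by
      intro y
      by_cases h : pairAt e j y ∈ G K <;> simp [b, h]
    have hm : MeasurableSet (pairAt e j ⁻¹' (G K)ᶜ) := measurable_pairAt e j (hG K).compl
    simp_rw [e1]
    rw [lintegral_indicator hm, setLIntegral_one, hν, Measure.map_apply hseq hm]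
    rfl
  have hlim : ∀ j, Tendsto (fun K => μ {ω | pairAt e j (fun t => Y t ω) ∉ G K}) atTop (𝓝 0) := by
    intro j
    have hnull : μ (⋂ K, {ω | pairAt e j (fun t => Y t ω) ∉ G K}) = 0 := by
      have := hae j
      rw [ae_iff] at this
      rw [← this]
      congr 1
      ext ω
      simp
    rw [← hnull]
    refine tendsto_measure_iInter_atTop (fun K => ?_) (fun K K' h ω hω hω' => hω (hmono h hω'))
      ⟨0, measure_ne_top _ _⟩
    exact (((measurable_pairAt e j).comp hseq) (hG K).compl).nullMeasurableSet
  have hlim' : Tendsto (fun K => ∫⁻ y, (f K y : ENNReal) ∂ν) atTop (𝓝 0) := by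
    have e2 : ∀ K, ∫⁻ y, (f K y : ENNReal) ∂ν =
        ∑ j ∈ Finset.range p, μ {ω | pairAt e j (fun t => Y t ω) ∉ G K} := by
      intro K
      simp only [f, Nat.cast_sum]
      have hm : ∀ j, Measurable fun y => (b K j y : ENNReal) := fun j =>
        (measurable_of_countable (fun k : ℕ => (k : ENNReal))).comp (hb K j)
      rw [lintegral_finsetSum _ fun j _ => hm j]
      exact Finset.sum_congr rfl fun j _ => hbint K j
    simp_rw [e2]
    simpa using tendsto_finsetSum (Finset.range p) fun j _ => hlim j
  have hc : (0 : ENNReal) < ((η / (L + 1) : ℝ≥0) : ENNReal) := by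
    rw [ENNReal.coe_pos]
    positivity
  obtain ⟨K, hK⟩ := (hlim'.eventually (gt_mem_nhds hc)).exists
  refine ⟨K, ?_⟩
  have hmax := measure_exists_lt_birkhoffSum_le hT (hf K) L _ hK.le
  have hle : (L : ENNReal) * ((η / (L + 1) : ℝ≥0) : ENNReal) ≤ η := by
    norm_cast
    rw [← NNReal.coe_le_coe]
    push_cast
    rw [mul_div_assoc', div_le_iff₀ (by positivity)]
    nlinarith [η.2]
  refine le_trans ?_ (hmax.trans hle)
  rw [hν, Measure.map_apply hseq]
  · refine measure_mono fun ω hω => ?_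
    obtain ⟨N, hN⟩ := hω
    -- `m` is the least number of periods that covers `N` pairs
    refine ⟨(N + p - 1) / p, ?_⟩
    rw [hsum]
    have h1 : N ≤ (N + p - 1) / p * p := by
      have := Nat.div_add_mod (N + p - 1) p
      have := Nat.mod_lt (N + p - 1) hp
      rw [mul_comm]
      lia
    have h2 : (N + p - 1) / p ≤ N := by
      rw [Nat.div_le_iff_le_mul_add_pred hp]
      have := Nat.le_mul_of_pos_left N hp
      lia
    calc (N + p - 1) / p ≤ N := h2
      _ < _ := hN
      _ ≤ _ := by gcongr
  · have : {x | ∃ m, m < L * birkhoffSum T (f K) m x} =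
        ⋃ m, {x | m < L * birkhoffSum T (f K) m x} := by
      ext; simp
    rw [this]
    refine MeasurableSet.iUnion fun m => measurableSet_lt measurable_const ?_
    simp_rw [hsum]
    exact (Finset.measurable_sum _ fun j _ => hb K j).const_mul L

/-! ### Gilbert–Varshamov codes -/

lemma card_hammingBall_le {A : Type*} [Fintype A] [DecidableEq A] [Nonempty A] {N : ℕ}
    (x : Fin N → A) (r : ℕ) :
    (Finset.univ.filter fun y => hammingDist x y ≤ r).card ≤ 2 ^ N * Fintype.card A ^ r := by
  have hsub : (Finset.univ.filter fun y => hammingDist x y ≤ r) ⊆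
      (Finset.univ.filter fun S : Finset (Fin N) => S.card ≤ r).biUnion fun S =>
        Fintype.piFinset fun i => if i ∈ S then Finset.univ else {x i} := by
    intro y hy
    simp only [Finset.mem_filter, Finset.mem_univ, true_and] at hy
    simp only [Finset.mem_biUnion, Finset.mem_filter, Finset.mem_univ, true_and,
      Fintype.mem_piFinset]
    refine ⟨Finset.univ.filter fun i => x i ≠ y i, hy, fun i => ?_⟩
    by_cases h : x i = y i <;> simp [h]
  refine (Finset.card_le_card hsub).trans (Finset.card_biUnion_le_card_mul _ _ _ fun S hS => ?_)
    |>.trans (Nat.mul_le_mul_right _ ?_)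
  · simp only [Finset.mem_filter, Finset.mem_univ, true_and] at hS
    have : ∏ i, (if i ∈ S then (Finset.univ : Finset A) else {x i}).card =
        Fintype.card A ^ S.card := by
      simp [apply_ite Finset.card]
    rw [Fintype.card_piFinset, this]
    exact Nat.pow_le_pow_right Fintype.card_pos hS
  · refine (Finset.card_filter_le _ _).trans ?_
    simp

/-- Gilbert–Varshamov bound: a maximal code of length `N` with minimum distance greater than `r`
has at least `|A| ^ N / (2 ^ N * |A| ^ r)` codewords, as the balls of radius `r` around its codewords
cover everything. -/
theorem exists_code_of_min_dist (A : Type*) [Fintype A] [DecidableEq A] [Nonempty A] (N r : ℕ) :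
    ∃ (M : ℕ) (c : Fin M → Fin N → A), (∀ i j, i ≠ j → r < hammingDist (c i) (c j)) ∧
      Fintype.card A ^ N ≤ M * (2 ^ N * Fintype.card A ^ r) := by
  classical
  let good : Finset (Finset (Fin N → A)) :=
    Finset.univ.filter fun s => ∀ x ∈ s, ∀ y ∈ s, x ≠ y → r < hammingDist x y
  obtain ⟨s, hs, hmax⟩ := Finset.exists_max_image good Finset.card ⟨∅, by simp [good]⟩
  simp only [good, Finset.mem_filter, Finset.mem_univ, true_and] at hs hmax
  have hcover : (Finset.univ : Finset (Fin N → A)) ⊆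
      s.biUnion fun x => Finset.univ.filter fun y => hammingDist x y ≤ r := by
    intro y _
    by_contra hy
    simp only [Finset.mem_biUnion, Finset.mem_filter, Finset.mem_univ, true_and, not_exists,
      not_and, not_le] at hy
    have hys : y ∉ s := fun h => by simpa using hy y h
    have := hmax (insert y s) (by
      intro a ha b hb hab
      rcases Finset.mem_insert.1 ha with rfl | ha' <;>
        rcases Finset.mem_insert.1 hb with rfl | hb'
      · exact absurd rfl hab
      · rw [hammingDist_comm]; exact hy b hb'
      · exact hy a ha'
      · exact hs a ha' b hb' hab)
    rw [Finset.card_insert_of_notMem hys] at this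
    lia
  refine ⟨s.card, fun i => (s.equivFin.symm i : Fin N → A), fun i j hij => ?_, ?_⟩
  · exact hs _ (s.equivFin.symm i).2 _ (s.equivFin.symm j).2 fun h =>
      hij (s.equivFin.symm.injective (Subtype.ext h))
  · have := (Finset.card_le_card hcover).trans
      (Finset.card_biUnion_le_card_mul _ _ _ fun x _ => card_hammingBall_le x r)
    simpa using this

/-! ### Rare noise events -/

/-- For `n` independent samples that each lie in `B` with probability at most `8⁻¹ ^ L`, a union
bound over the sets of indices shows that it is exponentially unlikely that more than `N / L` of
them lie in `B`. -/
theorem pi_lt_mul_card_le {W : Type*} [MeasurableSpace W] (π : Measure W) [IsProbabilityMeasure π]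
    (B : Set W) [DecidablePred (· ∈ B)] (L n N : ℕ) (hB : π B ≤ (8⁻¹ : ENNReal) ^ L) :
    Measure.pi (fun _ : Fin n => π) {z | N < L * (Finset.univ.filter fun t => z t ∈ B).card} ≤
      2 ^ n * (8⁻¹ : ENNReal) ^ N := by
  have hsub : {z : Fin n → W | N < L * (Finset.univ.filter fun t => z t ∈ B).card} ⊆
      ⋃ S ∈ Finset.univ.filter fun S : Finset (Fin n) => N < L * S.card,
        Set.univ.pi fun t => if t ∈ S then B else Set.univ := by
    intro z hz
    simp only [Set.mem_iUnion]
    refine ⟨Finset.univ.filter fun t => z t ∈ B, by simpa using hz, fun t _ => ?_⟩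
    by_cases h : z t ∈ B <;> simp [h]
  refine (measure_mono hsub).trans ((measure_biUnion_finset_le _ _).trans ?_)
  refine (Finset.sum_le_card_nsmul _ _ ((8⁻¹ : ENNReal) ^ N) fun S hS => ?_).trans ?_
  · simp only [Finset.mem_filter, Finset.mem_univ, true_and] at hS
    have e : ∀ t, π (if t ∈ S then B else Set.univ) = if t ∈ S then π B else 1 := fun t => by
      split_ifs <;> simp
    rw [Measure.pi_pi]
    simp_rw [e]
    rw [Finset.prod_ite_mem, Finset.univ_inter, Finset.prod_const]
    calc π B ^ S.card ≤ ((8⁻¹ : ENNReal) ^ L) ^ S.card := by gcongr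
      _ = (8⁻¹ : ENNReal) ^ (L * S.card) := by rw [pow_mul]
      _ ≤ _ := pow_le_pow_of_le_one (by simp) (by simp) hS.le
  · rw [nsmul_eq_mul]
    gcongr
    have : (Finset.univ.filter fun S : Finset (Fin n) => N < L * S.card).card ≤ 2 ^ n :=
      (Finset.card_filter_le _ _).trans (by simp)
    exact_mod_cast this

/-! ### Generic and well-conditioned matrices -/

section Matrices

variable {𝕜 : Type*} [RCLike 𝕜] {m : ℕ}

/-- A linear family of matrices that contains the identity is almost everywhere invertible: along
each line in the direction of `v`, the determinant is a characteristic polynomial, with finitely many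
zeros. -/
lemma ae_det_ne_zero {E : Type*} [NormedAddCommGroup E] [NormedSpace ℝ E] [FiniteDimensional ℝ E]
    [MeasurableSpace E] [BorelSpace E] (ν : Measure E) [ν.IsAddHaarMeasure]
    (M : E →ₗ[ℝ] Matrix (Fin m) (Fin m) 𝕜) (v : E) (hv : M v = 1) :
    ∀ᵐ x ∂ν, (M x).det ≠ 0 := by
  have : ProperSpace E := FiniteDimensional.proper ℝ E
  have hc : Continuous fun x => (M x).det :=
    (LinearMap.continuous_of_finiteDimensional M).matrix_det
  refine ae_mem_of_ae_add_linearMap_mem (s := {x | (M x).det ≠ 0})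
    (LinearMap.toSpanSingleton ℝ E v) volume ν (isOpen_ne_fun hc continuous_const).measurableSet
    fun y => ?_
  have hfin : {t : ℝ | (M (y + LinearMap.toSpanSingleton ℝ E v t)).det = 0}.Finite := by
    refine Set.Finite.subset (((-(M y)).charpoly.roots.toFinset.finite_toSet).preimage
      (f := fun t : ℝ => (t : 𝕜)) (RCLike.ofReal_injective.injOn)) fun t ht => ?_
    simp only [Set.mem_preimage, Finset.mem_coe, Multiset.mem_toFinset]
    rw [Polynomial.mem_roots (Matrix.charpoly_monic _).ne_zero, Polynomial.IsRoot,
      Matrix.eval_charpoly]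
    rw [Set.mem_ofPred_eq] at ht
    rw [← ht]
    congr 1
    ext i j
    simp [hv, Matrix.scalar_apply, Matrix.diagonal_apply, Matrix.one_apply, add_comm,
      RCLike.real_smul_eq_coe_mul]
  rw [ae_iff]
  simpa using hfin.measure_zero volume

/-- Invertible matrices `M` such that the entries of `M⁻¹` are at most `K` in absolute value. The
bound is put on the adjugate, which is polynomial in the entries of `M`. -/
def wellConditioned (𝕜 : Type*) [RCLike 𝕜] (m K : ℕ) : Set (Matrix (Fin m) (Fin m) 𝕜) :=
  {M | M.det ≠ 0 ∧ ∀ i j, ‖M.adjugate i j‖ ≤ K * ‖M.det‖}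

lemma wellConditioned_mono : Monotone (wellConditioned 𝕜 m) := fun K K' h M hM =>
  ⟨hM.1, fun i j => (hM.2 i j).trans (by gcongr)⟩

lemma exists_mem_wellConditioned {M : Matrix (Fin m) (Fin m) 𝕜} (hM : M.det ≠ 0) :
    ∃ K, M ∈ wellConditioned 𝕜 m K := by
  obtain ⟨K, hK⟩ := exists_nat_ge ((∑ i, ∑ j, ‖M.adjugate i j‖) / ‖M.det‖)
  refine ⟨K, hM, fun i j => ?_⟩
  rw [div_le_iff₀ (norm_pos_iff.2 hM)] at hK
  refine le_trans ?_ hK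
  calc ‖M.adjugate i j‖ ≤ ∑ j, ‖M.adjugate i j‖ :=
        Finset.single_le_sum (f := fun j => ‖M.adjugate i j‖) (fun _ _ => norm_nonneg _)
          (Finset.mem_univ j)
    _ ≤ _ := Finset.single_le_sum (f := fun i => ∑ j, ‖M.adjugate i j‖)
          (fun _ _ => Finset.sum_nonneg fun _ _ => norm_nonneg _) (Finset.mem_univ i)

lemma measurableSet_preimage_wellConditioned {X : Type*} [TopologicalSpace X] [MeasurableSpace X]
    [OpensMeasurableSpace X] {f : X → Matrix (Fin m) (Fin m) 𝕜} (hf : Continuous f) (K : ℕ) :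
    MeasurableSet (f ⁻¹' wellConditioned 𝕜 m K) := by
  have e : f ⁻¹' wellConditioned 𝕜 m K = {x | (f x).det ≠ 0} ∩
      ⋂ i, ⋂ j, {x | ‖(f x).adjugate i j‖ ≤ K * ‖(f x).det‖} := by
    ext x; simp [wellConditioned]
  rw [e]
  refine (isOpen_ne_fun hf.matrix_det continuous_const).measurableSet.inter
    (MeasurableSet.iInter fun i => MeasurableSet.iInter fun j => ?_)
  exact (isClosed_le (hf.matrix_adjugate.matrix_elem i j).norm
    (continuous_const.mul hf.matrix_det.norm)).measurableSet

lemma norm_le_of_mem_wellConditioned {M : Matrix (Fin m) (Fin m) 𝕜} {K : ℕ}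
    (hM : M ∈ wellConditioned 𝕜 m K) (v : Fin m → 𝕜) : ‖v‖ ≤ m * K * ‖M.mulVec v‖ := by
  have h0 : 0 < ‖M.det‖ := norm_pos_iff.2 hM.1
  have e : M.det • v = M.adjugate.mulVec (M.mulVec v) := by
    rw [Matrix.mulVec_mulVec, Matrix.adjugate_mul, Matrix.smul_mulVec, Matrix.one_mulVec]
  have h1 : ‖M.adjugate.mulVec (M.mulVec v)‖ ≤ m * (K * ‖M.det‖) * ‖M.mulVec v‖ := by
    refine (pi_norm_le_iff_of_nonneg (by positivity)).2 fun i => ?_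
    calc ‖M.adjugate.mulVec (M.mulVec v) i‖ ≤ ∑ j, ‖M.adjugate i j * M.mulVec v j‖ :=
          norm_sum_le Finset.univ fun j => M.adjugate i j * M.mulVec v j
      _ ≤ ∑ _j : Fin m, K * ‖M.det‖ * ‖M.mulVec v‖ := by
          refine Finset.sum_le_sum fun j _ => ?_
          rw [norm_mul]
          gcongr
          · exact hM.2 i j
          · exact norm_le_pi_norm _ j
      _ = _ := by simp; ring
  rw [← e, norm_smul] at h1
  refine le_of_mul_le_mul_left ?_ h0
  linarith

end Matrices

/-! ### Constellations -/

/-- Scaled integer points in coordinates with respect to a basis of `𝕜` over `ℝ`: a constellation of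
`(Q + 1) ^ d` points, `d = dim 𝕜`, at mutual distance at least `s` and of norm at most `C * s * Q`.
This treats pulse amplitude modulation over `ℝ` and its quadrature version over `ℂ` alike. -/
lemma exists_constellation (𝕜 : Type*) [RCLike 𝕜] : ∃ C : ℝ, 1 ≤ C ∧ ∀ s : ℝ, 0 < s → ∀ Q : ℕ,
    ∃ pt : (Fin (Module.finrank ℝ 𝕜) → Fin (Q + 1)) → 𝕜,
      (∀ a, ‖pt a‖ ≤ C * s * Q) ∧ ∀ a b, a ≠ b → s ≤ ‖pt a - pt b‖ := by
  let e := (Module.finBasis ℝ 𝕜).equivFunL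
  set D : ℝ := ‖(e : 𝕜 →L[ℝ] (Fin (Module.finrank ℝ 𝕜) → ℝ))‖
  set D' : ℝ := ‖(e.symm : (Fin (Module.finrank ℝ 𝕜) → ℝ) →L[ℝ] 𝕜)‖
  refine ⟨D' * (D + 1) + 1, by
    have : 0 ≤ D := norm_nonneg _
    have : 0 ≤ D' := norm_nonneg _
    have : 0 ≤ D' * (D + 1) := by positivity
    linarith, fun s hs Q => ?_⟩
  have hD0 : 0 ≤ D := norm_nonneg _
  have hD0' : 0 ≤ D' := norm_nonneg _
  refine ⟨fun a => e.symm fun i => s * (D + 1) * (a i : ℕ), fun a => ?_, fun a b hab => ?_⟩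
  · have h1 : ‖fun i => s * (D + 1) * ((a i : ℕ) : ℝ)‖ ≤ s * (D + 1) * Q := by
      refine (pi_norm_le_iff_of_nonneg (by positivity)).2 fun i => ?_
      rw [Real.norm_of_nonneg (by positivity)]
      gcongr
      lia
    calc _ ≤ D' * ‖fun i => s * (D + 1) * ((a i : ℕ) : ℝ)‖ :=
          (e.symm : (Fin (Module.finrank ℝ 𝕜) → ℝ) →L[ℝ] 𝕜).le_opNorm _
      _ ≤ D' * (s * (D + 1) * Q) := by gcongr
      _ ≤ _ := by nlinarith [mul_nonneg hs.le (Nat.cast_nonneg (α := ℝ) Q)]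
  · obtain ⟨i, hi⟩ := Function.ne_iff.1 hab
    set w : 𝕜 := e.symm (fun i => s * (D + 1) * ((a i : ℕ) : ℝ)) -
      e.symm (fun i => s * (D + 1) * ((b i : ℕ) : ℝ)) with hw
    have h1 : ‖e w‖ ≤ D * ‖w‖ := (e : 𝕜 →L[ℝ] (Fin (Module.finrank ℝ 𝕜) → ℝ)).le_opNorm w
    have h2 : s * (D + 1) ≤ ‖e w i‖ := by
      simp only [hw, map_sub, ContinuousLinearEquiv.apply_symm_apply, Pi.sub_apply]
      rw [← mul_sub, norm_mul, Real.norm_of_nonneg (by positivity)]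
      refine le_mul_of_one_le_right (by positivity) ?_
      have : ((a i : ℕ) : ℤ) - (b i : ℕ) ≠ 0 := by
        rw [sub_ne_zero]
        exact_mod_cast fun h => hi (Fin.ext h)
      have := Int.one_le_abs this
      rw [Real.norm_eq_abs]
      exact_mod_cast this
    have h3 : s * (D + 1) ≤ (D + 1) * ‖w‖ := by
      have := h2.trans ((norm_le_pi_norm (e w) i).trans h1)
      nlinarith [norm_nonneg w]
    nlinarith

/-- Any sequence can be traversed slowly enough to become negligible against `log P`. -/
lemma exists_slow_index (A : ℕ → ℝ) : ∃ κ : ℝ → ℕ, Tendsto κ atTop atTop ∧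
    Tendsto (fun P => A (κ P) / Real.log P) atTop (𝓝 0) := by
  let p : ℝ → ℕ → Prop := fun P k => (k + 1) * |A k| ≤ Real.log P
  classical
  let κ : ℝ → ℕ := fun P => Nat.findGreatest (p P) ⌊P⌋₊
  have hev : ∀ k, ∀ᶠ P in atTop, p P k := fun k => Real.tendsto_log_atTop.eventually_ge_atTop _
  have hκ : Tendsto κ atTop atTop := by
    refine tendsto_atTop.2 fun k => ?_
    filter_upwards [hev k, eventually_ge_atTop (k : ℝ)] with P hP hk
    exact Nat.le_findGreatest (Nat.le_floor hk) hP
  refine ⟨κ, hκ, ?_⟩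
  have hlim : Tendsto (fun P => ((κ P : ℝ) + 1)⁻¹) atTop (𝓝 0) :=
    tendsto_inv_atTop_zero.comp
      (tendsto_atTop_add_const_right _ 1 (tendsto_natCast_atTop_atTop.comp hκ))
  refine squeeze_zero_norm' ?_ hlim
  filter_upwards [hev 0, eventually_gt_atTop 1] with P h0 h1
  have hs : p P (κ P) := Nat.findGreatest_spec (P := p P) (Nat.zero_le _) h0
  have hl : 0 < Real.log P := Real.log_pos h1
  rw [Real.norm_eq_abs, abs_div, abs_of_pos hl, div_le_iff₀ hl, inv_mul_eq_div,
    le_div_iff₀ (by positivity)]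
  linarith [hs]

/-! ### Concatenated codes: inner code, outer code and minimum-distance decoding -/

instance isProbabilityMeasure_noiseLaw (𝕜 : Type*) [RCLike 𝕜] :
    IsProbabilityMeasure (noiseLaw 𝕜) := by
  refine Measure.isProbabilityMeasure_map (Measurable.aemeasurable ?_)
  have h : Continuous fun p : ℝ × ℝ => (p.1 : 𝕜) + (p.2 : 𝕜) * RCLike.I :=
    (RCLike.continuous_ofReal.comp continuous_fst).add
      ((RCLike.continuous_ofReal.comp continuous_snd).mul continuous_const)
  exact h.measurable

/-- A scheme for two consecutive channel uses, in which user `k` sends a symbol of the alphabet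
`A k`. Instead of estimating its symbol, a receiver tests each symbol against what it has received.
-/
structure InnerCode (𝕜 : Type*) [RCLike 𝕜] {K : ℕ} (nT nR : Fin K → ℕ) (A : Fin K → Type*) where
  /-- the signal sent over the two channel uses -/
  enc : (k : Fin K) → A k → Fin 2 → Fin (nT k) → 𝕜
  /-- the pairs (channel states, received signal) that are consistent with a given symbol -/
  test : (k : Fin K) → A k → Set ((Fin 2 → RxState 𝕜 nT nR k) × (Fin 2 → Fin (nR k) → 𝕜))
  measurableSet_test : ∀ k a, MeasurableSet (test k a)

namespace InnerCode

variable {𝕜 : Type*} [RCLike 𝕜] {K : ℕ} {nT nR : Fin K → ℕ} {A : Fin K → Type*}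

/-- The signal received over the two channel uses. -/
def output (I : InnerCode 𝕜 nT nR A) (k : Fin K) (h : Fin 2 → RxState 𝕜 nT nR k)
    (x : (j : Fin K) → A j) (z : Fin 2 → Fin (nR k) → 𝕜) : Fin 2 → Fin (nR k) → 𝕜 :=
  fun s r => ∑ j, ∑ a, h s j r a * I.enc j (x j) s a + z s r

/-- The tests of receiver `k` are error-free, in that exactly the transmitted symbol passes, if the
noise has norm at most `ρ`, the channel states lie in `V` and, for the rejection of all other symbols,
also in `G`. Acceptance does not depend on the conditioning of the channel. -/
structure Reliable (I : InnerCode 𝕜 nT nR A) (k : Fin K) (ρ : ℝ)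
    (V G : Set (Fin 2 → RxState 𝕜 nT nR k)) : Prop where
  accept : ∀ h ∈ V, ∀ x z, (∀ s, ‖z s‖ ≤ ρ) → (h, I.output k h x z) ∈ I.test k (x k)
  reject : ∀ h ∈ V, h ∈ G → ∀ x z, (∀ s, ‖z s‖ ≤ ρ) → ∀ a, a ≠ x k →
    (h, I.output k h x z) ∉ I.test k a

/-- Channel use `s` of the `j`-th pair, among the `(n - 1) / 2` pairs of consecutive channel uses
that start at time `e ≤ 1` and fit into a block of length `n`. -/
def pairTime {n e : ℕ} (he : e ≤ 1) (j : Fin ((n - 1) / 2)) (s : Fin 2) : Fin n :=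
  ⟨e + 2 * j + s, by lia⟩

variable (I : InnerCode 𝕜 nT nR A) {n e : ℕ} (he : e ≤ 1) (L : ℕ)

/-- The number of pairs of channel uses in which a codeword fails the test. -/
noncomputable def failures (k : Fin K) (w : Fin ((n - 1) / 2) → A k)
    (q : (Fin n → RxState 𝕜 nT nR k) × RxSignal 𝕜 (nR k) n) : ℕ :=
  ∑ j, (I.test k (w j))ᶜ.indicator
    (1 : (Fin 2 → RxState 𝕜 nT nR k) × (Fin 2 → Fin (nR k) → 𝕜) → ℕ)
    (fun s => q.1 (pairTime he j s), fun s => q.2 (pairTime he j s))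

lemma measurable_failures (k : Fin K) (w : Fin ((n - 1) / 2) → A k) :
    Measurable (I.failures (n := n) he k w) := by
  refine Finset.measurable_sum _ fun j _ => ?_
  refine (measurable_one.indicator (I.measurableSet_test k (w j)).compl).comp ?_
  exact (measurable_pi_lambda _ fun s => (measurable_pi_apply _).comp measurable_fst).prodMk
    (measurable_pi_lambda _ fun s => (measurable_pi_apply _).comp measurable_snd)

lemma failures_eq_card (k : Fin K) (w : Fin ((n - 1) / 2) → A k)
    (q : (Fin n → RxState 𝕜 nT nR k) × RxSignal 𝕜 (nR k) n) [DecidablePred fun j =>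
      (fun s => q.1 (pairTime he j s), fun s => q.2 (pairTime he j s)) ∉ I.test k (w j)] :
    I.failures he k w q = (Finset.univ.filter fun j =>
      (fun s => q.1 (pairTime he j s), fun s => q.2 (pairTime he j s)) ∉ I.test k (w j)).card := by
  rw [failures, Finset.card_filter]
  refine Finset.sum_congr rfl fun j _ => ?_
  split_ifs with hj
  · exact Set.indicator_of_notMem (s := (I.test k (w j))ᶜ) (fun h' => h' hj) _
  · exact Set.indicator_of_mem (s := (I.test k (w j))ᶜ) hj _

open Classical in
/-- A solution of `p`, if there is one. -/
noncomputable def pick {m : ℕ} [NeZero m] (p : Fin m → Prop) : Fin m :=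
  if h : ∃ i, p i then h.choose else 0

lemma pick_eq {m : ℕ} [NeZero m] {p : Fin m → Prop} {i : Fin m} (hi : p i)
    (huniq : ∀ j, p j → j = i) : pick p = i := by
  rw [pick, dif_pos ⟨i, hi⟩]
  exact huniq _ (Exists.choose_spec (p := p) _)

/-- The concatenated code of length `n`: the symbols of a codeword of the outer code `c k` are sent
by the inner code, over the pairs of channel uses (nothing is sent outside of these), and the decoder
returns a codeword for which at most a fraction `1 / L` of the tests fails. -/
noncomputable def toCode (M : Fin K → ℕ) [∀ k, NeZero (M k)]
    (c : (k : Fin K) → Fin (M k) → Fin ((n - 1) / 2) → A k) : Code 𝕜 nT nR n where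
  M := M
  enc k m t a := if ht : e ≤ t ∧ (t - e) / 2 < (n - 1) / 2 then
    I.enc k (c k m ⟨(t - e) / 2, ht.2⟩) ⟨(t - e) % 2, by lia⟩ a else 0
  dec k h y := pick fun m => L * I.failures he k (c k m) (h, y) ≤ (n - 1) / 2
  measurable_dec k := by
    have h1 : Measurable fun p : Fin (M k) → Prop => pick p := measurable_of_countable _
    refine h1.comp (f := fun q m => L * I.failures he k (c k m) q ≤ (n - 1) / 2) ?_
    refine measurable_pi_lambda _ fun m => ?_
    refine measurableSet_setOfPred.1 ?_
    exact measurableSet_le ((I.measurable_failures he k (c k m)).const_mul L) measurable_const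

variable (M : Fin K → ℕ) [∀ k, NeZero (M k)]
    (c : (k : Fin K) → Fin (M k) → Fin ((n - 1) / 2) → A k)

lemma toCode_enc_pairTime (k : Fin K) (m : Fin (M k)) (j : Fin ((n - 1) / 2)) (s : Fin 2)  :
    (I.toCode he L M c).enc k m (pairTime he j s) = I.enc k (c k m j) s := by
  have h1 : (e + 2 * (j : ℕ) + s - e) / 2 = j := by lia
  have h2 : (e + 2 * (j : ℕ) + s - e) % 2 = s := by lia
  funext a
  simp only [toCode, pairTime, h1, h2]
  rw [dif_pos ⟨by lia, j.2⟩]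

lemma toCode_powerConstraint {P : ℝ} (hP : 0 ≤ P) (hpow : ∀ k a s, ∑ i, ‖I.enc k a s i‖ ^ 2 ≤ P) :
    (I.toCode he L M c).PowerConstraint P := by
  intro k m
  calc _ ≤ ∑ _t : Fin n, P := by
        refine Finset.sum_le_sum fun t _ => ?_
        by_cases ht : e ≤ (t : ℕ) ∧ (t - e) / 2 < (n - 1) / 2
        · simpa only [toCode, dif_pos ht] using hpow _ _ _
        · simpa only [toCode, dif_neg ht, norm_zero, zero_pow two_ne_zero,
            Finset.sum_const_zero] using hP
    _ = n * P := by simp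

variable {I L M c}

/-- If at most a fraction `1 / L` of the pairs has a bad channel, and at most a fraction `1 / L` has
large noise, then an outer code of relative minimum distance greater than `3 / L` is decoded
correctly. -/
lemma dec_toCode_eq [∀ k, DecidableEq (A k)] {k : Fin K} {ρ : ℝ}
    {V G : Set (Fin 2 → RxState 𝕜 nT nR k)}
    (hI : I.Reliable k ρ V G)
    (hdist : ∀ m m', m ≠ m' → 3 * ((n - 1) / 2) < L * hammingDist (c k m) (c k m'))
    {h : Fin n → RxState 𝕜 nT nR k} (hV : ∀ j, (fun s => h (pairTime he j s)) ∈ V)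
    (hG : L * ∑ j, Gᶜ.indicator (1 : (Fin 2 → RxState 𝕜 nT nR k) → ℕ)
      (fun s => h (pairTime he j s)) ≤ (n - 1) / 2)
    (m : (j : Fin K) → Fin (M j)) (z : RxSignal 𝕜 (nR k) n)
    [DecidablePred (· ∈ {w : Fin (nR k) → 𝕜 | ρ < ‖w‖})]
    (hz : L * (Finset.univ.filter fun t => z t ∈ {w : Fin (nR k) → 𝕜 | ρ < ‖w‖}).card
      ≤ (n - 1) / 2) :
    (I.toCode he L M c).dec k h ((I.toCode he L M c).output k h m z) = m k := by
  classical
  set y := (I.toCode he L M c).output k h m z with hy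
  have hout : ∀ j, (fun s => y (pairTime he j s)) = I.output k (fun s => h (pairTime he j s))
      (fun i => c i (m i) j) (fun s => z (pairTime he j s)) := by
    intro j
    funext s r
    simp only [hy, Code.output, output, toCode_enc_pairTime]
  -- pairs of channel uses with large noise
  let Bz : Finset (Fin ((n - 1) / 2)) :=
    Finset.univ.filter fun j => ¬ ∀ s, ‖z (pairTime he j s)‖ ≤ ρ
  -- pairs of channel uses with a bad channel
  let Bh : Finset (Fin ((n - 1) / 2)) :=
    Finset.univ.filter fun j => (fun s => h (pairTime he j s)) ∉ G
  have hBz : L * Bz.card ≤ (n - 1) / 2 := by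
    refine le_trans (Nat.mul_le_mul_left L ?_) hz
    rw [← Finset.card_map Fin.valEmbedding]
    refine le_trans (Finset.card_le_card fun i hi => ?_)
      (Finset.card_image_le (f := fun t : Fin n => ((t : ℕ) - e) / 2))
    obtain ⟨j, hj, rfl⟩ := Finset.mem_map.1 hi
    simp only [Bz, Finset.mem_filter, Finset.mem_univ, true_and, not_forall, not_le] at hj
    obtain ⟨s, hs⟩ := hj
    refine Finset.mem_image.2 ⟨pairTime he j s, by simpa using hs, ?_⟩
    simp only [pairTime, Fin.valEmbedding_apply]
    lia
  have hBh : L * Bh.card ≤ (n - 1) / 2 := by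
    convert hG using 2
    rw [Finset.card_filter]
    exact Finset.sum_congr rfl fun j _ => by simp [Set.indicator_apply]
  have htrue : L * I.failures he k (c k (m k)) (h, y) ≤ (n - 1) / 2 := by
    refine le_trans (Nat.mul_le_mul_left L ?_) hBz
    rw [failures_eq_card]
    refine Finset.card_le_card fun j hj => ?_
    simp only [Bz, Finset.mem_filter, Finset.mem_univ, true_and] at hj ⊢
    intro hs
    refine hj ?_
    rw [hout]
    exact hI.accept _ (hV j) (fun i => c i (m i) j) _ hs
  have hfalse : ∀ m', L * I.failures he k (c k m') (h, y) ≤ (n - 1) / 2 → m' = m k := by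
    intro m' hm'
    by_contra hne
    have hd := hdist _ _ hne
    have hcard : hammingDist (c k m') (c k (m k)) ≤
        I.failures he k (c k m') (h, y) + Bz.card + Bh.card := by
      rw [failures_eq_card, hammingDist]
      refine le_trans (Finset.card_le_card fun j hj => ?_)
        ((Finset.card_union_le _ _).trans (Nat.add_le_add_right (Finset.card_union_le _ _) _))
      simp only [Bz, Bh, Finset.mem_filter, Finset.mem_univ, true_and, Finset.mem_union] at hj ⊢
      by_contra! hcon
      obtain ⟨⟨h1, h2⟩, h3⟩ := hcon
      refine hI.reject _ (hV j) h3 (fun i => c i (m i) j) _ h2 _ hj ?_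
      rw [← hout]
      exact h1
    have := Nat.mul_le_mul_left L hcard
    rw [mul_add, mul_add] at this
    lia
  exact pick_eq htrue hfalse

/-- For channel states that are bad in at most a fraction `1 / L` of the pairs, the error probability
is at most the probability that the noise is large too often. -/
theorem errorProb_toCode_le [∀ k, DecidableEq (A k)] {k : Fin K} {ρ : ℝ}
    {V G : Set (Fin 2 → RxState 𝕜 nT nR k)}
    (hI : I.Reliable k ρ V G)
    (hdist : ∀ m m', m ≠ m' → 3 * ((n - 1) / 2) < L * hammingDist (c k m) (c k m'))
    (hρ : (Measure.pi fun _ : Fin (nR k) => noiseLaw 𝕜) {w | ρ < ‖w‖} ≤ (8⁻¹ : ENNReal) ^ L)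
    {h : Fin n → RxState 𝕜 nT nR k} (hV : ∀ j, (fun s => h (pairTime he j s)) ∈ V)
    (hG : L * ∑ j, Gᶜ.indicator (1 : (Fin 2 → RxState 𝕜 nT nR k) → ℕ)
      (fun s => h (pairTime he j s)) ≤ (n - 1) / 2) :
    (I.toCode he L M c).errorProb k h ≤ 2 ^ n * 8⁻¹ ^ ((n - 1) / 2) := by
  classical
  have hpt : ∀ m : (j : Fin K) → Fin (M j), (noise 𝕜 (nR k) n).real
      {z | (I.toCode he L M c).dec k h ((I.toCode he L M c).output k h m z) ≠ m k} ≤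
        2 ^ n * 8⁻¹ ^ ((n - 1) / 2) := by
    intro m
    refine ENNReal.toReal_le_of_le_ofReal (by positivity) ?_
    have e8 : ENNReal.ofReal (2 ^ n * 8⁻¹ ^ ((n - 1) / 2)) =
        2 ^ n * (8⁻¹ : ENNReal) ^ ((n - 1) / 2) := by
      rw [ENNReal.ofReal_mul (by positivity), ENNReal.ofReal_pow (by positivity),
        ENNReal.ofReal_pow (by positivity), ENNReal.ofReal_inv_of_pos (by norm_num)]
      norm_num
    rw [e8]
    refine le_trans (measure_mono fun z hz => ?_)
      (pi_lt_mul_card_le (Measure.pi fun _ : Fin (nR k) => noiseLaw 𝕜) {w | ρ < ‖w‖} L n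
        ((n - 1) / 2) hρ)
    by_contra hcon
    exact hz (dec_toCode_eq he hI hdist hV hG m z (not_lt.1 hcon))
  rw [Code.errorProb]
  refine div_le_of_le_mul₀ (by positivity) (by positivity) ?_
  refine (Finset.sum_le_card_nsmul _ _ _ fun m _ => hpt m).trans ?_
  rw [nsmul_eq_mul, mul_comm]
  rfl

end InnerCode

/-! ### The alignment scheme for the staggered two-user channel -/

/-- The number of constellation points that each user sends in two channel uses. -/
abbrev symbolCount : Fin 2 → ℕ := ![2, 3]

instance secondCountableTopology_rxState (𝕜 : Type*) [RCLike 𝕜] {K : ℕ} (nT nR : Fin K → ℕ)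
    (i : Fin K) : SecondCountableTopology (RxState 𝕜 nT nR i) := inferInstance

instance borelSpace_pair_rxState (𝕜 : Type*) [RCLike 𝕜] {K : ℕ} (nT nR : Fin K → ℕ)
    (i : Fin K) : BorelSpace (Fin 2 → RxState 𝕜 nT nR i) := Pi.borelSpace

instance opensMeasurableSpace_pair_rxState_prod (𝕜 : Type*) [RCLike 𝕜] {K : ℕ}
    (nT nR : Fin K → ℕ) (i : Fin K) (r : ℕ) :
    OpensMeasurableSpace ((Fin 2 → RxState 𝕜 nT nR i) × (Fin 2 → Fin r → 𝕜)) := inferInstance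

section Residuals

variable {𝕜 : Type*} [RCLike 𝕜] {X : Type*} {pt : X → 𝕜} {ρ s : ℝ} {K : ℕ}

/-- The system that receiver 1 solves once the interference is cancelled: its columns are the direct
channels `g 0` and `g 1` in the two channel uses. -/
def directMatrix (g : Fin 2 → Fin 2 → 𝕜) : Matrix (Fin 2) (Fin 2) 𝕜 := Matrix.of fun r c => g c r

/-- The system that receiver 2 solves in a single channel use: the channel from all four transmit
antennas, with the antenna of user 1 first. -/
def fullMatrix (g₁ : Fin 4 → 𝕜) (g₂ : Fin 4 → Fin 3 → 𝕜) : Matrix (Fin 4) (Fin 4) 𝕜 :=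
  Matrix.of fun r => Fin.cons (g₁ r) (g₂ r)

/-- What is left at receiver 1 of the difference of the signals received in the two channel uses,
after subtraction of the contribution of the symbols `a` of user 1. -/
def differenceResidual (pt : X → 𝕜) (g y : Fin 2 → Fin 2 → 𝕜) (a : Fin 2 → X) : Fin 2 → 𝕜 :=
  fun r => y 0 r - y 1 r - (g 0 r * pt (a 0) - g 1 r * pt (a 1))

/-- What is left at receiver 2 of the signal received in one channel use, after subtraction of the
contributions of the symbols `b` of user 1 and `a` of user 2. -/
def fullResidual (pt : X → 𝕜) (g₁ : Fin 4 → 𝕜) (g₂ : Fin 4 → Fin 3 → 𝕜) (y : Fin 4 → 𝕜)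
    (b : X) (a : Fin 3 → X) : Fin 4 → 𝕜 :=
  fun r => y r - (g₁ r * pt b + ∑ i, g₂ r i * pt (a i))

/-- The interference `c`, being the same in both channel uses, cancels. -/
lemma differenceResidual_eq {g y z : Fin 2 → Fin 2 → 𝕜} {c : Fin 2 → 𝕜} {x : Fin 2 → X}
    (hy : ∀ s r, y s r = g s r * pt (x s) + c r + z s r) (a : Fin 2 → X) :
    differenceResidual pt g y a =
      (directMatrix g).mulVec ![pt (x 0) - pt (a 0), pt (a 1) - pt (x 1)] + (z 0 - z 1) := by
  funext r
  simp only [differenceResidual, hy, Pi.add_apply, Pi.sub_apply, Matrix.mulVec, dotProduct,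
    Fin.sum_univ_two, directMatrix, Matrix.of_apply, Matrix.cons_val_zero, Matrix.cons_val_one]
  ring

lemma fullResidual_eq {g₁ y z : Fin 4 → 𝕜} {g₂ : Fin 4 → Fin 3 → 𝕜} {x₁ : X} {x₂ : Fin 3 → X}
    (hy : ∀ r, y r = g₁ r * pt x₁ + ∑ i, g₂ r i * pt (x₂ i) + z r) (b : X) (a : Fin 3 → X) :
    fullResidual pt g₁ g₂ y b a =
      (fullMatrix g₁ g₂).mulVec
        (Fin.cons (pt x₁ - pt b) fun i : Fin 3 => pt (x₂ i) - pt (a i)) + z := by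
  funext r
  simp only [fullResidual, hy, Pi.add_apply, Matrix.mulVec, dotProduct, fullMatrix,
    Matrix.of_apply]
  rw [Fin.sum_univ_succ (n := 3)]
  simp only [Fin.cons_zero, Fin.cons_succ, mul_sub, Finset.sum_sub_distrib]
  ring

lemma norm_differenceResidual_le {g y z : Fin 2 → Fin 2 → 𝕜} {c : Fin 2 → 𝕜} {x : Fin 2 → X}
    (hy : ∀ s r, y s r = g s r * pt (x s) + c r + z s r) (hz : ∀ s, ‖z s‖ ≤ ρ) :
    ‖differenceResidual pt g y x‖ ≤ 2 * ρ := by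
  rw [differenceResidual_eq hy]
  have : (![pt (x 0) - pt (x 0), pt (x 1) - pt (x 1)] : Fin 2 → 𝕜) = 0 := by
    ext i; fin_cases i <;> simp
  rw [this, Matrix.mulVec_zero, zero_add]
  exact (norm_sub_le _ _).trans (by linarith [hz 0, hz 1])

lemma lt_norm_differenceResidual {g y z : Fin 2 → Fin 2 → 𝕜} {c : Fin 2 → 𝕜} {x : Fin 2 → X}
    (hy : ∀ s r, y s r = g s r * pt (x s) + c r + z s r) (hz : ∀ s, ‖z s‖ ≤ ρ)
    (hg : directMatrix g ∈ wellConditioned 𝕜 2 K)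
    (hsep : ∀ a b, a ≠ b → s ≤ ‖pt a - pt b‖) (hs : 8 * K * ρ < s) {a : Fin 2 → X} (ha : a ≠ x) :
    2 * ρ < ‖differenceResidual pt g y a‖ := by
  by_contra! hr
  rw [differenceResidual_eq hy] at hr
  set v : Fin 2 → 𝕜 := ![pt (x 0) - pt (a 0), pt (a 1) - pt (x 1)]
  have h1 : ‖v‖ ≤ (2 : ℕ) * K * ‖(directMatrix g).mulVec v‖ :=
    norm_le_of_mem_wellConditioned hg v
  have h2 : ‖(directMatrix g).mulVec v‖ ≤ 4 * ρ := by
    rw [← add_sub_cancel_right ((directMatrix g).mulVec v) (z 0 - z 1)]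
    refine (norm_sub_le _ _).trans ?_
    linarith [norm_sub_le (z 0) (z 1), hz 0, hz 1]
  have h3 : s ≤ ‖v‖ := by
    obtain ⟨i, hi⟩ := Function.ne_iff.1 ha
    refine le_trans ?_ (norm_le_pi_norm v i)
    fin_cases i
    · exact hsep _ _ (Ne.symm hi)
    · exact hsep _ _ hi
  have h4 : (2 : ℕ) * K * ‖(directMatrix g).mulVec v‖ ≤ (2 : ℕ) * K * (4 * ρ) := by gcongr
  push_cast at h1 h4
  linarith

lemma norm_fullResidual_le {g₁ y z : Fin 4 → 𝕜} {g₂ : Fin 4 → Fin 3 → 𝕜} {x₁ : X} {x₂ : Fin 3 → X}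
    (hy : ∀ r, y r = g₁ r * pt x₁ + ∑ i, g₂ r i * pt (x₂ i) + z r) (hz : ‖z‖ ≤ ρ) :
    ‖fullResidual pt g₁ g₂ y x₁ x₂‖ ≤ ρ := by
  have : fullResidual pt g₁ g₂ y x₁ x₂ = z := by
    funext r
    rw [fullResidual, hy]
    ring
  rwa [this]

lemma lt_norm_fullResidual {g₁ y z : Fin 4 → 𝕜} {g₂ : Fin 4 → Fin 3 → 𝕜} {x₁ : X} {x₂ : Fin 3 → X}
    (hy : ∀ r, y r = g₁ r * pt x₁ + ∑ i, g₂ r i * pt (x₂ i) + z r) (hz : ‖z‖ ≤ ρ)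
    (hg : fullMatrix g₁ g₂ ∈ wellConditioned 𝕜 4 K)
    (hsep : ∀ a b, a ≠ b → s ≤ ‖pt a - pt b‖) (hs : 8 * K * ρ < s) {a : Fin 3 → X} (ha : a ≠ x₂)
    (b : X) : ρ < ‖fullResidual pt g₁ g₂ y b a‖ := by
  by_contra! hr
  rw [fullResidual_eq hy] at hr
  set v : Fin 4 → 𝕜 := Fin.cons (pt x₁ - pt b) fun i : Fin 3 => pt (x₂ i) - pt (a i)
  have h1 : ‖v‖ ≤ (4 : ℕ) * K * ‖(fullMatrix g₁ g₂).mulVec v‖ :=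
    norm_le_of_mem_wellConditioned hg v
  have h2 : ‖(fullMatrix g₁ g₂).mulVec v‖ ≤ 2 * ρ := by
    rw [← add_sub_cancel_right ((fullMatrix g₁ g₂).mulVec v) z]
    refine (norm_sub_le _ _).trans ?_
    linarith
  have h3 : s ≤ ‖v‖ := by
    obtain ⟨i, hi⟩ := Function.ne_iff.1 ha
    refine le_trans ?_ (norm_le_pi_norm v (Fin.succ i))
    exact hsep _ _ (Ne.symm hi)
  have h4 : (4 : ℕ) * K * ‖(fullMatrix g₁ g₂).mulVec v‖ ≤ (4 : ℕ) * K * (2 * ρ) := by gcongr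
  push_cast at h1 h4
  linarith

lemma continuous_fullMatrix {Y : Type*} [TopologicalSpace Y] {g₁ : Y → Fin 4 → 𝕜}
    {g₂ : Y → Fin 4 → Fin 3 → 𝕜} (h₁ : Continuous g₁) (h₂ : Continuous g₂) :
    Continuous fun y => fullMatrix (g₁ y) (g₂ y) := by
  refine continuous_matrix fun r c => ?_
  simp only [fullMatrix, Matrix.of_apply]
  refine Fin.cases ?_ (fun i => ?_) c
  · simp only [Fin.cons_zero]
    fun_prop
  · simp only [Fin.cons_succ]
    fun_prop

end Residuals

section Staggered

variable {𝕜 : Type*} [RCLike 𝕜] {X : Type*} (pt : X → 𝕜) (ρ : ℝ)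

/-- User 1 sends a fresh constellation point in each of the two channel uses; user 2 sends a point
from each of its three antennas, and repeats them in the second channel use. -/
def staggeredEnc : (k : Fin 2) → (Fin (symbolCount k) → X) → Fin 2 → Fin (txAntennas k) → 𝕜
  | 0, a, s, _ => pt (a s)
  | 1, a, _, i => pt (a i)

/-- The gains of the direct link at receiver 1, by channel use and receive antenna. -/
def directGains (h : Fin 2 → RxState 𝕜 txAntennas rxAntennas 0) : Fin 2 → Fin 2 → 𝕜 :=
  fun s r => h s 0 r (0 : Fin 1)

/-- The gains from user 1 to receiver 2 in the first of two channel uses. -/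
def crossGains (h : Fin 2 → RxState 𝕜 txAntennas rxAntennas 1) : Fin 4 → 𝕜 :=
  fun r => h 0 0 r (0 : Fin 1)

/-- Receiver 1 tests the difference of the two received signals. Receiver 2 tests the first received
signal, jointly with some symbol of user 1. -/
def staggeredTest : (k : Fin 2) → (Fin (symbolCount k) → X) →
    Set ((Fin 2 → RxState 𝕜 txAntennas rxAntennas k) × (Fin 2 → Fin (rxAntennas k) → 𝕜))
  | 0, a => {q | ‖differenceResidual pt (directGains q.1) q.2 a‖ ≤ 2 * ρ}
  | 1, a => ⋃ b, {q | ‖fullResidual pt (crossGains q.1) (q.1 0 1) (q.2 0) b a‖ ≤ ρ}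

/-- At receiver 1, the interfering link is constant over the two channel uses. -/
def alignedStates (𝕜 : Type*) [RCLike 𝕜] :
    (k : Fin 2) → Set (Fin 2 → RxState 𝕜 txAntennas rxAntennas k)
  | 0 => {h | h 0 1 = h 1 1}
  | 1 => Set.univ

/-- The linear system that a receiver solves is well-conditioned. -/
def goodStates (𝕜 : Type*) [RCLike 𝕜] :
    (k : Fin 2) → ℕ → Set (Fin 2 → RxState 𝕜 txAntennas rxAntennas k)
  | 0, K => (fun h => directMatrix (directGains h)) ⁻¹' wellConditioned 𝕜 2 K
  | 1, K => (fun h => fullMatrix (crossGains h) (h 0 1)) ⁻¹' wellConditioned 𝕜 4 K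

lemma measurableSet_goodStates : ∀ k K, MeasurableSet (goodStates 𝕜 k K)
  | 0, K => by
    refine measurableSet_preimage_wellConditioned ?_ K
    refine continuous_matrix fun r c => ?_
    simp only [directMatrix, directGains, Matrix.of_apply]
    fun_prop
  | 1, K => by
    refine measurableSet_preimage_wellConditioned (continuous_fullMatrix ?_ ?_) K
    · unfold crossGains
      fun_prop
    · exact (continuous_apply 1).comp (continuous_apply 0)

lemma goodStates_mono : ∀ k, Monotone (goodStates 𝕜 k)
  | 0 => fun _ _ h _ hM => wellConditioned_mono h hM
  | 1 => fun _ _ h _ hM => wellConditioned_mono h hM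

lemma measurableSet_staggeredTest [Finite X] :
    ∀ k a, MeasurableSet (staggeredTest pt ρ k a)
  | 0, a => by
    have h : Continuous fun q : (Fin 2 → RxState 𝕜 txAntennas rxAntennas 0) ×
        (Fin 2 → Fin 2 → 𝕜) => differenceResidual pt (directGains q.1) q.2 a := by
      unfold differenceResidual directGains
      fun_prop
    exact (isClosed_le h.norm continuous_const).measurableSet
  | 1, a => by
    have h : ∀ b, Continuous fun q : (Fin 2 → RxState 𝕜 txAntennas rxAntennas 1) ×
        (Fin 2 → Fin 4 → 𝕜) => fullResidual pt (crossGains q.1) (q.1 0 1) (q.2 0) b a := by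
      intro b
      unfold fullResidual crossGains
      fun_prop
    exact MeasurableSet.iUnion fun b => (isClosed_le (h b).norm continuous_const).measurableSet

/-- The inner code for constellation `pt` and noise radius `ρ`. -/
def staggeredCode [Finite X] :
    InnerCode 𝕜 txAntennas rxAntennas fun k => Fin (symbolCount k) → X where
  enc := staggeredEnc pt
  test := staggeredTest pt ρ
  measurableSet_test := measurableSet_staggeredTest pt ρ

variable {pt ρ}

lemma sum_norm_sq_staggeredEnc_le {B P : ℝ} (hB : ∀ x, ‖pt x‖ ≤ B) (hP : 3 * B ^ 2 ≤ P) :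
    ∀ k a s, ∑ i, ‖staggeredEnc pt k a s i‖ ^ 2 ≤ P
  | 0, a, s => by
    have := pow_le_pow_left₀ (norm_nonneg _) (hB (a s)) 2
    have e : ∑ i, ‖staggeredEnc pt 0 a s i‖ ^ 2 = ‖pt (a s)‖ ^ 2 := Fin.sum_univ_one _
    rw [e]
    nlinarith [sq_nonneg B]
  | 1, a, s => by
    have e : ∑ i, ‖staggeredEnc pt 1 a s i‖ ^ 2 = ∑ i : Fin 3, ‖pt (a i)‖ ^ 2 := rfl
    rw [e]
    have : ∑ i : Fin 3, ‖pt (a i)‖ ^ 2 ≤ ∑ _i : Fin 3, B ^ 2 :=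
      Finset.sum_le_sum fun i _ => pow_le_pow_left₀ (norm_nonneg _) (hB (a i)) 2
    refine this.trans ?_
    simpa using hP

lemma staggeredCode_output [Finite X] (k : Fin 2) (h : Fin 2 → RxState 𝕜 txAntennas rxAntennas k)
    (x : (j : Fin 2) → Fin (symbolCount j) → X) (z : Fin 2 → Fin (rxAntennas k) → 𝕜)
    (s : Fin 2) (r : Fin (rxAntennas k)) :
    (staggeredCode pt ρ).output k h x z s r =
      h s 0 r (0 : Fin 1) * pt (x 0 s) + ∑ i : Fin 3, h s 1 r i * pt (x 1 i) + z s r := by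
  rw [InnerCode.output, Fin.sum_univ_two]
  congr 2
  exact Fin.sum_univ_one _

/-- Solving a system of at most four unknowns whose inverse has entries bounded by `K` amplifies the
noise to at most `8 * K * ρ`, which is less than the separation of the constellation. -/
theorem staggeredCode_reliable [Finite X] {s : ℝ} {K : ℕ}
    (hsep : ∀ a b, a ≠ b → s ≤ ‖pt a - pt b‖) (hs : 8 * K * ρ < s) :
    ∀ k, (staggeredCode pt ρ).Reliable k ρ (alignedStates 𝕜 k) (goodStates 𝕜 k K)
  | 0 => by
    have hy : ∀ (h : Fin 2 → RxState 𝕜 txAntennas rxAntennas 0), h 0 1 = h 1 1 →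
        ∀ (x : (j : Fin 2) → Fin (symbolCount j) → X) (z : Fin 2 → Fin 2 → 𝕜) (s r : Fin 2),
        (staggeredCode pt ρ).output 0 h x z s r =
          directGains h s r * pt (x 0 s) + ∑ i : Fin 3, h 0 1 r i * pt (x 1 i) + z s r := by
      intro h hh x z s r
      have hs : h s 1 = h 0 1 := by
        fin_cases s
        · rfl
        · exact hh.symm
      rw [← hs]
      exact staggeredCode_output 0 h x z s r
    exact ⟨fun h hV x z hz => norm_differenceResidual_le (hy h hV x z) hz,
      fun h hV hG x z hz a ha hmem =>
        (lt_norm_differenceResidual (hy h hV x z) hz hG hsep hs ha).not_ge hmem⟩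
  | 1 => by
    refine ⟨fun h hV x z hz => Set.mem_iUnion.2 ⟨x 0 (0 : Fin 2), ?_⟩,
      fun h hV hG x z hz a ha hmem => ?_⟩
    · exact norm_fullResidual_le (staggeredCode_output 1 h x z 0) (hz 0)
    · obtain ⟨b, hb⟩ := Set.mem_iUnion.1 hmem
      exact (lt_norm_fullResidual (staggeredCode_output 1 h x z 0) (hz 0) hG hsep hs ha b).not_ge hb

end Staggered

/-! ### Generic channel states are invertible -/

section Genericity

variable {𝕜 : Type*} [RCLike 𝕜] {Ω : Type*} [MeasurableSpace Ω] {μ : Measure Ω}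

lemma IsGeneric.ae_det_ne_zero {E : Type*} [NormedAddCommGroup E] [NormedSpace ℝ E]
    [FiniteDimensional ℝ E] [MeasurableSpace E] [BorelSpace E] {Y : Ω → E} (hY : IsGeneric μ Y)
    {m : ℕ} (M : E →ₗ[ℝ] Matrix (Fin m) (Fin m) 𝕜) (v : E) (hv : M v = 1) :
    ∀ᵐ ω ∂μ, (M (Y ω)).det ≠ 0 := by
  have : ProperSpace E := FiniteDimensional.proper ℝ E
  exact ae_of_ae_map hY.1.aemeasurable
    (hY.2.ae_le (MIMOIC.ae_det_ne_zero Measure.addHaar M v hv))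

lemma ae_det_directMatrix_ne_zero {Y : Ω → (Fin 2 → Fin 1 → 𝕜) × (Fin 2 → Fin 1 → 𝕜) ×
    (Fin 2 → Fin 3 → 𝕜)} (hY : IsGeneric μ Y) :
    ∀ᵐ ω ∂μ, (directMatrix ![fun r => (Y ω).1 r 0, fun r => (Y ω).2.1 r 0]).det ≠ 0 := by
  let M : ((Fin 2 → Fin 1 → 𝕜) × (Fin 2 → Fin 1 → 𝕜) × (Fin 2 → Fin 3 → 𝕜)) →ₗ[ℝ]
      Matrix (Fin 2) (Fin 2) 𝕜 :=
    { toFun := fun q => directMatrix ![fun r => q.1 r 0, fun r => q.2.1 r 0]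
      map_add' := fun p q => by
        ext r c
        fin_cases c <;> simp [directMatrix]
      map_smul' := fun t q => by
        ext r c
        fin_cases c <;> simp [directMatrix] }
  refine hY.ae_det_ne_zero M (fun r _ => if r = 0 then 1 else 0, fun r _ => if r = 1 then 1 else 0,
    0) ?_
  ext r c
  fin_cases c <;> simp [M, directMatrix, Matrix.one_apply]

lemma ae_det_fullMatrix_ne_zero {Y : Ω → (Fin 4 → Fin 1 → 𝕜) × (Fin 4 → Fin 3 → 𝕜)}
    (hY : IsGeneric μ Y) :
    ∀ᵐ ω ∂μ, (fullMatrix (fun r => (Y ω).1 r 0) (Y ω).2).det ≠ 0 := by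
  let M : ((Fin 4 → Fin 1 → 𝕜) × (Fin 4 → Fin 3 → 𝕜)) →ₗ[ℝ] Matrix (Fin 4) (Fin 4) 𝕜 :=
    { toFun := fun q => fullMatrix (fun r => q.1 r 0) q.2
      map_add' := fun p q => by
        ext r c
        refine Fin.cases ?_ (fun i => ?_) c <;> simp [fullMatrix]
      map_smul' := fun t q => by
        ext r c
        refine Fin.cases ?_ (fun i => ?_) c <;> simp [fullMatrix] }
  refine hY.ae_det_ne_zero M (fun r _ => if r = 0 then 1 else 0,
    fun r i => if r = i.succ then 1 else 0) ?_
  ext r c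
  refine Fin.cases ?_ (fun i => ?_) c <;> simp [M, fullMatrix, Matrix.one_apply]

end Genericity

/-! ### Rates -/

section Rates

/-- The number of codewords in the Gilbert–Varshamov bound, in exponential form. -/
lemma exp_le_of_pow_le {q M N L : ℕ} (hq : 0 < q)
    (h : q ^ N ≤ M * (2 ^ N * q ^ (3 * N / L))) :
    Real.exp (N * ((1 - 3 / L) * Real.log q - Real.log 2)) ≤ M := by
  have hq' : (1 : ℝ) ≤ q := by exact_mod_cast hq
  have h' : (q : ℝ) ^ N ≤ M * (2 ^ N * q ^ (3 * N / L)) := by exact_mod_cast h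
  have hD : (0 : ℝ) < 2 ^ N * q ^ (3 * N / L) := by positivity
  refine le_of_mul_le_mul_right (le_trans ?_ h') hD
  have e1 : (q : ℝ) ^ N = Real.exp (N * Real.log q) := by
    rw [← Real.log_pow, Real.exp_log (by positivity)]
  have e2 : (2 : ℝ) ^ N * q ^ (3 * N / L) =
      Real.exp (N * Real.log 2 + (3 * N / L : ℕ) * Real.log q) := by
    rw [Real.exp_add, ← Real.log_pow, ← Real.log_pow, Real.exp_log (by positivity),
      Real.exp_log (by positivity)]
  rw [e1, e2, ← Real.exp_add]
  refine Real.exp_le_exp.2 ?_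
  have h3 : ((3 * N / L : ℕ) : ℝ) ≤ 3 * N / L := by
    refine Nat.cast_div_le.trans ?_
    push_cast
    rfl
  have h4 := mul_le_mul_of_nonneg_right h3 (Real.log_nonneg hq')
  have h5 : (N : ℝ) * ((1 - 3 / L) * Real.log q - Real.log 2) =
    N * Real.log q - 3 * N / L * Real.log q - N * Real.log 2 := by ring
  linarith

/-- The number of pairs differs from `n / 2` by at most one. -/
lemma eventually_mul_le_pairs_mul (B : ℝ) :
    ∀ᶠ n : ℕ in atTop, (n : ℝ) * (B / 2 - 1) ≤ ((n - 1) / 2 : ℕ) * B := by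
  filter_upwards [tendsto_natCast_atTop_atTop.eventually_ge_atTop |B|] with n hn
  have h1 : (n : ℝ) ≤ 2 * ((n - 1) / 2 : ℕ) + 2 := by
    exact_mod_cast (show n ≤ 2 * ((n - 1) / 2) + 2 by lia)
  have h2 : (2 : ℝ) * ((n - 1) / 2 : ℕ) ≤ n := by
    exact_mod_cast (show 2 * ((n - 1) / 2) ≤ n by lia)
  rcases le_total 0 B with hB | hB
  · rw [abs_of_nonneg hB] at hn
    nlinarith
  · rw [abs_of_nonpos hB] at hn
    nlinarith

lemma tendsto_two_pow_mul_inv_eight_pow :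
    Tendsto (fun n : ℕ => (2 : ℝ) ^ n * 8⁻¹ ^ ((n - 1) / 2)) atTop (𝓝 0) := by
  have hN : Tendsto (fun n : ℕ => (n - 1) / 2) atTop atTop :=
    tendsto_atTop.2 fun b => by
      filter_upwards [eventually_ge_atTop (2 * b + 1)] with n hn
      lia
  have hlim : Tendsto (fun n : ℕ => 4 * (2⁻¹ : ℝ) ^ ((n - 1) / 2)) atTop (𝓝 0) := by
    simpa using ((tendsto_pow_atTop_nhds_zero_of_lt_one (r := (2⁻¹ : ℝ)) (by norm_num)
      (by norm_num)).comp hN).const_mul 4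
  refine squeeze_zero (fun n => by positivity) (fun n => ?_) hlim
  calc (2 : ℝ) ^ n * 8⁻¹ ^ ((n - 1) / 2) ≤ 2 ^ (2 * ((n - 1) / 2) + 2) * 8⁻¹ ^ ((n - 1) / 2) := by
        gcongr
        · norm_num
        · lia
    _ = 4 * (2⁻¹ : ℝ) ^ ((n - 1) / 2) := by
        rw [pow_add, pow_mul, mul_right_comm, ← mul_pow]
        norm_num [mul_comm]

/-- The number `Q` of constellation points per real dimension, less one, for which points of norm
`C * s * Q` on three antennas have total power at most `P`. -/
noncomputable def levels (C P s : ℝ) : ℕ := ⌊√(P / 3) / (C * s)⌋₊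

lemma mul_levels_le {C P s : ℝ} (hC : 0 < C) (hs : 0 < s) (hP : 0 ≤ P) :
    3 * (C * s * levels C P s) ^ 2 ≤ P := by
  have h1 : C * s * levels C P s ≤ √(P / 3) := by
    have := Nat.floor_le (show 0 ≤ √(P / 3) / (C * s) by positivity)
    rw [le_div_iff₀ (by positivity)] at this
    unfold levels
    linarith
  have h2 := pow_le_pow_left₀ (by positivity) h1 2
  rw [Real.sq_sqrt (by positivity)] at h2
  linarith

/-- The number of constellation points per real dimension is `P ^ (1 / 2 + o(1))` as long as their
separation `s` is `P ^ o(1)`. -/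
lemma tendsto_log_levels {C : ℝ} (hC : 1 ≤ C) {s : ℝ → ℝ} (hs : ∀ P, 1 ≤ s P)
    (hlim : Tendsto (fun P => Real.log (s P) / Real.log P) atTop (𝓝 0)) :
    Tendsto (fun P => Real.log (levels C P (s P) + 1) / Real.log P) atTop (𝓝 (1 / 2)) := by
  set c := Real.log C + Real.log 3 + Real.log 2
  have hb : Tendsto (fun P => c / Real.log P + Real.log (s P) / Real.log P) atTop (𝓝 0) := by
    simpa using (Real.tendsto_log_atTop.const_div_atTop c).add hlim
  rw [← tendsto_sub_nhds_zero_iff]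
  refine squeeze_zero_norm' ?_ hb
  filter_upwards [eventually_gt_atTop 1] with P hP
  have hlog : 0 < Real.log P := Real.log_pos hP
  have hP0 : 0 < P := by linarith
  have hC0 : 0 < C := by linarith
  have hs0 : 0 < s P := by linarith [hs P]
  have hlC := Real.log_nonneg hC
  have hls := Real.log_nonneg (hs P)
  have hl2 := Real.log_nonneg (show (1 : ℝ) ≤ 2 by norm_num)
  have hl3 := Real.log_nonneg (show (1 : ℝ) ≤ 3 by norm_num)
  have hlow : Real.log P / 2 - Real.log 3 / 2 - Real.log C - Real.log (s P) ≤
      Real.log (levels C P (s P) + 1) := by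
    have h1 : √(P / 3) / (C * s P) ≤ levels C P (s P) + 1 := (Nat.lt_floor_add_one _).le
    have h2 := Real.log_le_log (by positivity) h1
    rw [Real.log_div (by positivity) (by positivity), Real.log_sqrt (by positivity),
      Real.log_div (by positivity) (by positivity), Real.log_mul (by positivity) (by positivity)]
      at h2
    linarith
  have hup : Real.log (levels C P (s P) + 1) ≤ Real.log P / 2 + Real.log 2 := by
    have h1 : (levels C P (s P) : ℝ) ≤ √P := by
      refine (Nat.floor_le (by positivity)).trans ?_
      refine (div_le_self (by positivity) (by nlinarith [hs P])).trans ?_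
      exact Real.sqrt_le_sqrt (by linarith)
    have h2 : 1 ≤ √P := Real.one_le_sqrt.2 hP.le
    have h3 := Real.log_le_log (by positivity)
      (show (levels C P (s P) : ℝ) + 1 ≤ √P * 2 by linarith)
    rwa [Real.log_mul (by positivity) (by norm_num), Real.log_sqrt hP0.le] at h3
  rw [Real.norm_eq_abs, ← add_div, div_sub' hlog.ne', abs_div, abs_of_pos hlog]
  gcongr
  rw [abs_le]
  constructor <;> linarith

/-- The rate per channel use of a user that sends, in two channel uses, `a` points of a constellation
of `q ^ d` points, protected by an outer code of relative minimum distance `3 / L`. The final `- 1`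
absorbs the channel uses lost at the ends of a block. -/
noncomputable def rate (d a : ℕ) (L q : ℝ) : ℝ :=
  ((1 - 3 / L) * (a * (d * Real.log q)) - Real.log 2) / 2 - 1

lemma tendsto_rate_div {d : ℕ} (hd : 0 < d) (a : ℕ) {L q : ℝ → ℝ} (hL : Tendsto L atTop atTop)
    (hq : Tendsto (fun P => Real.log (q P) / Real.log P) atTop (𝓝 (1 / 2))) :
    Tendsto (fun P => rate d a (L P) (q P) / (d / 2 * Real.log P)) atTop (𝓝 (a / 2)) := by
  have h1 : Tendsto (fun P => a * (1 - 3 / L P) * (Real.log (q P) / Real.log P) -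
      (Real.log 2 + 2) / d / Real.log P) atTop (𝓝 (a * (1 - 0) * (1 / 2) - 0)) :=
    (((tendsto_const_nhds.sub (hL.const_div_atTop 3)).const_mul _).mul hq).sub
      (Real.tendsto_log_atTop.const_div_atTop _)
  have e : (a * (1 - 0) * (1 / 2) - 0 : ℝ) = a / 2 := by ring
  rw [e] at h1
  refine h1.congr' ?_
  filter_upwards [eventually_gt_atTop 1] with P hP
  have hlog : Real.log P ≠ 0 := (Real.log_pos hP).ne'
  have hd' : (d : ℝ) ≠ 0 := by exact_mod_cast hd.ne'
  unfold rate
  generalize 3 / L P = w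
  field_simp
  ring

end Rates

/-! ### Codes of a given level -/

lemma exists_noise_radius (𝕜 : Type*) [RCLike 𝕜] (r L : ℕ) :
    ∃ ρ₀ : ℝ, ∀ ρ ≥ ρ₀, (Measure.pi fun _ : Fin r => noiseLaw 𝕜) {w | ρ < ‖w‖} ≤
      (8⁻¹ : ENNReal) ^ L := by
  set π := Measure.pi fun _ : Fin r => noiseLaw 𝕜
  have hlim : Tendsto (fun R : ℕ => π {w | (R : ℝ) < ‖w‖}) atTop (𝓝 0) := by
    have hnull : π (⋂ R : ℕ, {w | (R : ℝ) < ‖w‖}) = 0 := by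
      have : (⋂ R : ℕ, {w : Fin r → 𝕜 | (R : ℝ) < ‖w‖}) = ∅ := by
        ext w
        obtain ⟨R, hR⟩ := exists_nat_ge ‖w‖
        simpa using ⟨R, hR⟩
      rw [this, measure_empty]
    rw [← hnull]
    refine tendsto_measure_iInter_atTop (fun R => ?_) (fun R R' h w hw => ?_)
      ⟨0, measure_ne_top _ _⟩
    · exact (isOpen_lt continuous_const continuous_norm).measurableSet.nullMeasurableSet
    · show (R : ℝ) < ‖w‖
      exact (Nat.cast_le.2 h).trans_lt hw
  have hpos : (0 : ENNReal) < 8⁻¹ ^ L := ENNReal.pow_pos (by simp) L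
  obtain ⟨R, hR⟩ := (hlim.eventually (gt_mem_nhds hpos)).exists
  exact ⟨R, fun ρ hρ => (measure_mono fun w hw => lt_of_le_of_lt hρ hw).trans hR.le⟩

/-- The concatenated codes at a given power and level `L`. -/
theorem exists_staggered_code {𝕜 : Type*} [RCLike 𝕜] {X : Type*} [Fintype X] [DecidableEq X]
    [Nonempty X] (pt : X → 𝕜) {B P s : ℝ} (hB : ∀ x, ‖pt x‖ ≤ B) (hBP : 3 * B ^ 2 ≤ P)
    (hsep : ∀ a b, a ≠ b → s ≤ ‖pt a - pt b‖) (ρ : ℝ) {e : ℕ} (he : e ≤ 1) {L : ℕ} (hL : 0 < L)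
    (n : ℕ) :
    ∃ C : Code 𝕜 txAntennas rxAntennas n, C.PowerConstraint P ∧
      (∀ k, Real.exp (((n - 1) / 2 : ℕ) *
        ((1 - 3 / L) * (symbolCount k * Real.log (Fintype.card X)) - Real.log 2)) ≤ C.M k) ∧
      ∀ (k : Fin 2) (K : ℕ), 8 * K * ρ < s →
        (Measure.pi fun _ : Fin (rxAntennas k) => noiseLaw 𝕜) {w | ρ < ‖w‖} ≤
          (8⁻¹ : ENNReal) ^ L →
        ∀ h : ℕ → RxState 𝕜 txAntennas rxAntennas k,
          (∀ j, pairAt e j h ∈ alignedStates 𝕜 k) →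
          L * ∑ j ∈ Finset.range ((n - 1) / 2), (goodStates 𝕜 k K)ᶜ.indicator
            (1 : (Fin 2 → RxState 𝕜 txAntennas rxAntennas k) → ℕ) (pairAt e j h) ≤ (n - 1) / 2 →
          C.errorProb k (fun t => h t) ≤ 2 ^ n * 8⁻¹ ^ ((n - 1) / 2) := by
  classical
  have hex := fun k : Fin 2 => exists_code_of_min_dist (Fin (symbolCount k) → X) ((n - 1) / 2)
    (3 * ((n - 1) / 2) / L)
  choose M c hdist hcard using hex
  have hM : ∀ k, NeZero (M k) := fun k => ⟨fun h0 => by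
    have := hcard k
    rw [h0, zero_mul] at this
    exact absurd this (not_le.2 (pow_pos Fintype.card_pos _))⟩
  refine ⟨(staggeredCode pt ρ).toCode he L M c, ?_, fun k => ?_, fun k K hK hρ h hV hG => ?_⟩
  · exact InnerCode.toCode_powerConstraint _ he L M c (le_trans (by positivity) hBP)
      (sum_norm_sq_staggeredEnc_le hB hBP)
  · have := exp_le_of_pow_le Fintype.card_pos (hcard k)
    rw [Fintype.card_fun, Fintype.card_fin, Nat.cast_pow, Real.log_pow] at this
    exact this
  · refine InnerCode.errorProb_toCode_le he (staggeredCode_reliable hsep hK k) (fun m m' hm => ?_)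
      hρ (fun j => hV j) ?_
    · have := hdist k m m' hm
      rw [Nat.div_lt_iff_lt_mul hL] at this
      lia
    · rw [Finset.sum_range] at hG
      exact hG

/-! ### Almost sure achievability -/

/-- Pairs start at times of the parity of `o₁ + 1`, so that a block boundary of the direct link of
receiver 1 separates the two channel uses of each pair. -/
lemma ae_exists_mem_goodStates {𝕜 : Type*} [RCLike 𝕜] {Ω : Type*} [MeasurableSpace Ω]
    {μ : Measure Ω} {H : (i : Fin 2) → ℕ → Ω → RxState 𝕜 txAntennas rxAntennas i} {o₁ : ℕ}
    (hgen₁ : ∀ t, ¬ SameBlock 2 o₁ t (t + 1) →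
      IsGeneric μ (fun ω => (H 0 t ω 0, H 0 (t + 1) ω 0, H 0 t ω 1)))
    (hgen₂ : ∀ t, IsGeneric μ (fun ω => (H 1 t ω 0, H 1 t ω 1))) (j : ℕ) :
    ∀ k, ∀ᵐ ω ∂μ, ∃ K, pairAt ((o₁ + 1) % 2) j (fun t => H k t ω) ∈ goodStates 𝕜 k K
  | 0 => by
    have hg := hgen₁ ((o₁ + 1) % 2 + 2 * j) (by unfold SameBlock; lia)
    filter_upwards [ae_det_directMatrix_ne_zero hg] with ω hω
    obtain ⟨K, hK⟩ := exists_mem_wellConditioned hω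
    refine ⟨K, ?_⟩
    have e : directMatrix (directGains (pairAt ((o₁ + 1) % 2) j fun t => H 0 t ω)) =
        directMatrix ![fun r => H 0 ((o₁ + 1) % 2 + 2 * j) ω 0 r (0 : Fin 1),
          fun r => H 0 ((o₁ + 1) % 2 + 2 * j + 1) ω 0 r (0 : Fin 1)] := by
      ext r c
      fin_cases c <;> rfl
    show directMatrix _ ∈ wellConditioned 𝕜 2 K
    rw [e]
    exact hK
  | 1 => by
    filter_upwards [ae_det_fullMatrix_ne_zero (hgen₂ ((o₁ + 1) % 2 + 2 * j))] with ω hω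
    exact exists_mem_wellConditioned hω

/-- As the blocks are staggered, no block boundary of the interfering link of receiver 1 separates the
two channel uses of a pair. -/
lemma pairAt_mem_alignedStates {𝕜 : Type*} [RCLike 𝕜] {Ω : Type*}
    {H : (i : Fin 2) → ℕ → Ω → RxState 𝕜 txAntennas rxAntennas i} {o₁ o₂ : ℕ}
    (hstag : o₁ % 2 ≠ o₂ % 2) (hblock₂ : IsBlockFading H 0 1 2 o₂) (ω : Ω) (j : ℕ) :
    ∀ k, pairAt ((o₁ + 1) % 2) j (fun t => H k t ω) ∈ alignedStates 𝕜 k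
  | 0 => hblock₂ _ _ (by unfold SameBlock; simp only [Fin.val_zero, Fin.val_one]; lia) ω
  | 1 => Set.mem_univ _

end MIMOIC

theorem theorem4 {𝕜 : Type*} [RCLike 𝕜] {Ω : Type*} [MeasurableSpace Ω]
    (μ : Measure Ω) [IsProbabilityMeasure μ]
    (H : (i : Fin 2) → ℕ → Ω → RxState 𝕜 txAntennas rxAntennas i)
    (hmeas : ∀ i t, Measurable (H i t))
    (o₁ o₂ : ℕ)
    (hstag : o₁ % 2 ≠ o₂ % 2)
    (hblock₁ : IsBlockFading H 0 0 2 o₁)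
    (hblock₂ : IsBlockFading H 0 1 2 o₂)
    (hgen₁ : ∀ t, ¬ SameBlock 2 o₁ t (t + 1) →
      IsGeneric μ (fun ω => (H 0 t ω 0, H 0 (t + 1) ω 0, H 0 t ω 1)))
    (hgen₂ : ∀ t, IsGeneric μ (fun ω => (H 1 t ω 0, H 1 t ω 1)))
    (hstat : ∀ i, IsCyclostationary μ H i) :
    AchievesDoF μ H ![1, 3 / 2] := by
  set e := (o₁ + 1) % 2
  -- at some time, more than a fraction `1 / L` of the pairs so far has a bad channel
  let bad : (k : Fin 2) → ℕ → ℕ → Set Ω := fun k K L => {ω | ∃ N, N < L * ∑ j ∈ Finset.range N,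
    (goodStates 𝕜 k K)ᶜ.indicator
      (1 : (Fin 2 → RxState 𝕜 txAntennas rxAntennas k) → ℕ) (pairAt e j fun t => H k t ω)}
  have hK : ∀ (k : Fin 2) (ℓ : ℕ), ∃ K, μ (bad k K (ℓ + 1)) ≤ ((2⁻¹ ^ ℓ : ℝ≥0) : ENNReal) := by
    intro k ℓ
    obtain ⟨p, hp, hid⟩ := hstat k
    exact exists_measure_bad_pairs_le (hmeas k) hp hid e (measurableSet_goodStates k)
      (goodStates_mono k) (fun j => ae_exists_mem_goodStates hgen₁ hgen₂ j k) (ℓ + 1) (by positivity)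
  choose K hK using hK
  have hρ : ∀ ℓ, ∃ ρ : ℝ, 0 ≤ ρ ∧ ∀ k : Fin 2,
      (Measure.pi fun _ : Fin (rxAntennas k) => noiseLaw 𝕜) {w | ρ < ‖w‖} ≤
        (8⁻¹ : ENNReal) ^ (ℓ + 1) := by
    intro ℓ
    choose ρ₀ hρ₀ using fun k : Fin 2 => exists_noise_radius 𝕜 (rxAntennas k) (ℓ + 1)
    refine ⟨max 0 (max (ρ₀ 0) (ρ₀ 1)), le_max_left _ _, fun k => hρ₀ k _ ?_⟩
    fin_cases k <;> simp
  choose ρ hρ0 hρ using hρ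
  -- the separation of the constellation at level `ℓ`
  let s : ℕ → ℝ := fun ℓ => 8 * (∑ k, (K k ℓ : ℝ)) * ρ ℓ + 1
  have hs1 : ∀ ℓ, 1 ≤ s ℓ := fun ℓ => by
    have := hρ0 ℓ
    have : 0 ≤ 8 * (∑ k, (K k ℓ : ℝ)) * ρ ℓ := by positivity
    simp only [s]
    linarith
  have hsK : ∀ k ℓ, 8 * K k ℓ * ρ ℓ < s ℓ := fun k ℓ => by
    have h1 : (K k ℓ : ℝ) ≤ ∑ k, (K k ℓ : ℝ) :=
      Finset.single_le_sum (f := fun k => (K k ℓ : ℝ)) (fun _ _ => Nat.cast_nonneg _)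
        (Finset.mem_univ k)
    have h2 := mul_le_mul_of_nonneg_right h1 (hρ0 ℓ)
    simp only [s]
    linarith
  -- at power `P` the codes of level `κ P` are used
  obtain ⟨κ, hκ, hκlim⟩ := exists_slow_index fun ℓ => Real.log (s ℓ)
  obtain ⟨C₀, hC₀, hconst⟩ := exists_constellation 𝕜
  choose pt hpt hsep using fun P : ℝ =>
    hconst (s (κ P)) (by linarith [hs1 (κ P)]) (levels C₀ P (s (κ P)))
  choose C hpow hrate herr using fun (P : ℝ) (hP : 0 < P) (n : ℕ) =>
    exists_staggered_code (pt P) (hpt P)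
      (mul_levels_le (by linarith) (by linarith [hs1 (κ P)]) hP.le) (hsep P) (ρ (κ P))
      (show e ≤ 1 by lia) (Nat.succ_pos (κ P)) n
  refine ⟨fun P k => rate (Module.finrank ℝ 𝕜) (symbolCount k) ((κ P : ℝ) + 1)
      (levels C₀ P (s (κ P)) + 1),
    fun P n => if hP : 0 < P then C P hP n else C 1 one_pos n, fun k => ?_, fun P hP n => ?_,
    fun P hP k => ?_, ?_⟩
  · have hlim := tendsto_rate_div (Module.finrank_pos (R := ℝ) (M := 𝕜)) (symbolCount k)
      (tendsto_atTop_add_const_right _ 1 (tendsto_natCast_atTop_atTop.comp hκ))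
      (tendsto_log_levels hC₀ (fun P => hs1 (κ P)) hκlim)
    have hd : (![1, 3 / 2] : Fin 2 → ℝ) k = symbolCount k / 2 := by
      fin_cases k <;> norm_num [symbolCount]
    rw [hd]
    exact hlim
  · simpa only [dif_pos hP] using hpow P hP n
  · filter_upwards [eventually_mul_le_pairs_mul ((1 - 3 / ((κ P : ℝ) + 1)) * (symbolCount k *
      ((Module.finrank ℝ 𝕜 : ℝ) * Real.log (levels C₀ P (s (κ P)) + 1))) - Real.log 2)] with n hn
    simp only [dif_pos hP]
    have h1 := hrate P hP n k
    rw [Fintype.card_fun, Fintype.card_fin, Fintype.card_fin, Nat.cast_pow, Real.log_pow] at h1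
    push_cast at h1
    exact (Real.exp_le_exp.2 hn).trans h1
  · -- Borel–Cantelli: almost surely, the channel is good at all high levels
    have hbc : ∀ k, ∀ᵐ ω ∂μ, ∀ᶠ ℓ in atTop, ω ∉ bad k (K k ℓ) (ℓ + 1) := fun k => by
      refine ae_eventually_notMem (ne_top_of_le_ne_top ?_ (ENNReal.tsum_le_tsum (hK k)))
      rw [← ENNReal.coe_tsum (NNReal.summable_geometric (by norm_num))]
      exact ENNReal.coe_ne_top
    filter_upwards [ae_all_iff.2 hbc] with ω hω
    filter_upwards [eventually_gt_atTop 0, hκ.eventually (eventually_all.2 hω)] with P hP hgood k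
    simp only [dif_pos hP]
    refine squeeze_zero (fun n => ?_) (fun n => ?_) tendsto_two_pow_mul_inv_eight_pow
    · exact div_nonneg (Finset.sum_nonneg fun _ _ => measureReal_nonneg) (Nat.cast_nonneg _)
    · refine herr P hP n k (K k (κ P)) (hsK k _) (hρ _ k) (fun t => H k t ω)
        (fun j => pairAt_mem_alignedStates hstag hblock₂ ω j k) ?_
      by_contra hlt
      exact hgood k ⟨_, not_le.1 hlt⟩
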